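/- For a finite set $E$ and a monotone submodular $f\colon 2^E\to\mathbb Z$, let $\mathcal M_f$ be the matroid induced by $f$: $F\subseteq E$ is independent if and only if $|I|\le f(I)$ for all nonempty $I\subseteq F$. For a graph $G=(V,E)$, the $(k,\ell)$-count matroid of $G$ is $\mathcal M_{c_{k,\ell}}$ with $c_{k,\ell}(F)=k|V(F)|-\ell$, where $V(F)$ is the set of vertices incident to edges of $F$; the $(1,1)$- and $(1,0)$-count matroids are the graphic and the bicircular matroid of $G$. For an irreducible variety $X\subseteq\mathbb C^E$, the algebraic matroid $\mathcal M(X)$ has as independent sets those $I\subseteq E$ for which the coordinate projection of $X$ to $\mathbb C^I$ is Zariski dense. The Hadamard product $X_1*\cdots*X_d$ is the Zariski closure of the set of coordinatewise products $x_1*\cdots*x_d$ with $x_i\in X_i$. In the weak order, $\mathcal N_1\preceq\mathcal N_2$ means that every independent set of $\mathcal N_1$ is independent in $\mathcal N_2$. Let $G=(V,E)$ be the graph with $20$ vertices $(i,j)$, $i\in\mathbb Z/4$, $0\le j\le 4$, in which for each $i$ the six vertices $(i,0),\dots,(i,4),(i+1,0)$ span a $K_6$ minus the edge joining $(i,0)$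 and $(i+1,0)$, and which has no other edges. Then: 1. $G$ is $(3,4)$-tight: $E$ is independent in the $(3,4)$-count matroid of $G$, and $|E|=3|V|-4$. 2. The graphic and the bicircular matroid of $G$ are representable over $\mathbb C$. Let $X_{1,1}$ and $X_{1,0}$ be any complex matrices, with rows indexed by $E$, that represent the graphic and the bicircular matroid of $G$, respectively, as row matroids, and let $L_{1,1},L_{1,0}\subseteq\mathbb C^E$ be their column spaces. Then neither space is contained in a coordinate hyperplane, $\mathcal M(L_{1,1})$ is the graphic matroid and $\mathcal M(L_{1,0})$ is the bicircular matroid of $G$. 3. With $r_1=r_2$ the rank function of $\mathcal M(L_{1,1})$ and $r_3$ that of $\mathcal M(L_{1,0})$, the matroid $\mathcal M(L_{1,1}*L_{1,1}*L_{1,0})$ is strictly smaller in the weak order than $\mathcal M_{r_1+r_2+r_3-2}$. The rank of $\mathcal M(L_{1,1}*L_{1,1}*L_{1,0})$ is at most $3|V|-5$, whereas $\mathcal M_{r_1+r_2+r_3-2}$ is the $(3,4)$-count matroid of $G$ and has rank $3|V|-4$. Consequently the following conjecture of Bernstein fails for $d=3$: if $L_1,\dots,L_d\subset\mathbb C^m$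 are linear spaces not contained in any coordinate hyperplane, with rank functions $r_1,\dots,r_d$, then $\mathcal M(L_1*\cdots*L_d)=\mathcal M_{r_1+\cdots+r_d-(d-1)}$. -/

import Mathlib

open MvPolynomial

/-! ### Matroids induced by monotone submodular functions -/

/-- An integer-valued monotone submodular set function on `E`; no condition on its value at `∅`. -/
structure MonotoneSubmodular (E : Type*) where
  toFun : Set E → ℤ
  mono : ∀ A B : Set E, A ⊆ B → toFun A ≤ toFun B
  submod : ∀ A B : Set E, toFun (A ∪ B) + toFun (A ∩ B) ≤ toFun A + toFun B

/-- `F` belongs to `I_f` if `|I| ≤ f(I)` for every nonempty `I ⊆ F`. -/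
def InducedIndep {E : Type*} (f : MonotoneSubmodular E) (F : Set E) : Prop :=
  ∀ I : Set E, I ⊆ F → I.Nonempty → (I.ncard : ℤ) ≤ f.toFun I

theorem InducedIndep.exists_insert {E : Type*} [Finite E] (f : MonotoneSubmodular E)
    {I J : Set E} (hI : InducedIndep f I) (hJ : InducedIndep f J) (hlt : I.ncard < J.ncard) :
    ∃ e ∈ J, e ∉ I ∧ InducedIndep f (insert e I) := by
  classical
  obtain ⟨_⟩ := nonempty_fintype E
  by_contra hcon
  push Not at hcon
  -- tight subsets of `I`
  let T : Set E → Prop := fun A => A ⊆ I ∧ A.Nonempty ∧ f.toFun A = A.ncard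
  have hTunion : ∀ A B, T A → T B → (A ∩ B).Nonempty → T (A ∪ B) := by
    rintro A B ⟨hAI, hA, hfA⟩ ⟨hBI, hB, hfB⟩ hAB
    refine ⟨Set.union_subset hAI hBI, hA.mono Set.subset_union_left, ?_⟩
    have h1 := hI (A ∪ B) (Set.union_subset hAI hBI) (hA.mono Set.subset_union_left)
    have h2 := hI (A ∩ B) (Set.inter_subset_left.trans hAI) hAB
    have h3 := f.submod A B
    have h4 := Set.ncard_union_add_ncard_inter A B
    have h5 : ((A ∪ B).ncard : ℤ) + (A ∩ B).ncard = A.ncard + B.ncard := by exact_mod_cast h4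
    linarith
  have hspan : ∀ e ∈ J, e ∉ I → ∃ A, T A ∧ f.toFun (insert e A) = f.toFun A := by
    intro e heJ heI
    have h := hcon e heJ heI
    simp only [InducedIndep, not_forall, not_le] at h
    obtain ⟨S, hS, hSne, hSlt⟩ := h
    have heS : e ∈ S := by
      by_contra heS
      have : S ⊆ I := fun x hx => (hS hx).resolve_left (fun h => heS (h ▸ hx))
      exact absurd (hI S this hSne) (not_le.2 hSlt)
    have hAI : S \ {e} ⊆ I := fun x hx => (hS hx.1).resolve_left hx.2
    have hins : insert e (S \ {e}) = S := by
      rw [Set.insert_sdiff_singleton, Set.insert_eq_of_mem heS]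
    have hcard : S.ncard = (S \ {e}).ncard + 1 := by
      conv_lhs => rw [← hins]
      exact Set.ncard_insert_of_notMem (fun h => h.2 rfl)
    have hAne : (S \ {e}).Nonempty := by
      rw [Set.nonempty_iff_ne_empty]
      intro h0
      have hSe : S = {e} := by rw [← hins, h0]; simp
      have h1 := hJ {e} (by simpa using heJ) ⟨e, rfl⟩
      rw [hSe] at hSlt
      linarith
    have h1 := hI _ hAI hAne
    have h2 := f.mono (S \ {e}) S Set.sdiff_subset
    rw [hcard] at hSlt
    push_cast at hSlt
    refine ⟨S \ {e}, ⟨hAI, hAne, by linarith⟩, ?_⟩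
    rw [hins]
    linarith
  -- maximal tight subsets of `I`
  let P : Finset (Set E) := Finset.univ.filter (fun A => Maximal T A)
  have hP : ∀ A, A ∈ P ↔ Maximal T A := fun A => by simp [P]
  have hdisj : ∀ A ∈ P, ∀ B ∈ P, A ≠ B → Disjoint A B := by
    intro A hA B hB hne
    rw [hP] at hA hB
    rw [Set.disjoint_iff_inter_eq_empty]
    by_contra h
    have h := hTunion A B hA.prop hB.prop (Set.nonempty_iff_ne_empty.2 h)
    exact hne ((hA.eq_of_subset h Set.subset_union_left).trans
      (hB.eq_of_subset h Set.subset_union_right).symm)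
  have hspan' : ∀ e ∈ J, e ∉ I → ∃ A ∈ P, f.toFun (insert e A) = f.toFun A := by
    intro e heJ heI
    obtain ⟨A, hA, hfA⟩ := hspan e heJ heI
    obtain ⟨B, hAB, hB⟩ := Finite.exists_le_maximal hA
    have hAB : A ⊆ B := hAB
    refine ⟨B, (hP B).2 hB, le_antisymm ?_ (f.mono _ _ (Set.subset_insert _ _))⟩
    have heB : e ∉ B := fun h => heI (hB.prop.1 h)
    have h := f.submod (insert e A) B
    have h1 : insert e A ∪ B = insert e B := by
      rw [Set.insert_union, Set.union_eq_self_of_subset_left hAB]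
    have h2 : insert e A ∩ B = A := by
      rw [Set.insert_inter_of_notMem heB, Set.inter_eq_self_of_subset_left hAB]
    rw [h1, h2] at h
    linarith
  let N : Set E → Set E := fun A => {e | e ∈ J ∧ e ∉ I ∧ f.toFun (insert e A) = f.toFun A}
  have hadd : ∀ A : Set E, ∀ K : Finset E, (∀ e ∈ K, f.toFun (insert e A) = f.toFun A) →
      f.toFun (A ∪ K) = f.toFun A := by
    intro A K
    induction K using Finset.induction_on with
    | empty => intro _; simp
    | insert a K ha ih =>
      intro h
      have ih := ih (fun e he => h e (Finset.mem_insert_of_mem he))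
      have ha := h a (Finset.mem_insert_self _ _)
      refine le_antisymm ?_ (f.mono _ _ Set.subset_union_left)
      have h1 := f.submod (A ∪ K) (insert a A)
      have h2 : (A ∪ K) ∪ insert a A = A ∪ ((insert a K : Finset E) : Set E) := by
        ext x; simp; tauto
      have h3 := f.mono A ((A ∪ K) ∩ insert a A)
        (Set.subset_inter Set.subset_union_left (Set.subset_insert _ _))
      rw [h2] at h1
      linarith
  have hkey : ∀ A ∈ P, (J ∩ A).ncard + (N A).ncard ≤ A.ncard := by
    intro A hA
    have hT := ((hP A).1 hA).prop
    have h1 : f.toFun (A ∪ N A) = A.ncard := by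
      have := hadd A (N A).toFinset (fun e he => (Set.mem_toFinset.1 he).2.2)
      rw [Set.coe_toFinset] at this
      rw [this, hT.2.2]
    have hd : Disjoint (J ∩ A) (N A) :=
      Set.disjoint_left.2 fun x hx hx' => hx'.2.1 (hT.1 hx.2)
    have h2 := Set.ncard_union_eq hd
    rw [← h2]
    rcases Set.eq_empty_or_nonempty (J ∩ A ∪ N A) with h0 | h0
    · simp [h0]
    · have h3 := hJ _ (Set.union_subset Set.inter_subset_left (fun x hx => hx.1)) h0
      have h4 := f.mono (J ∩ A ∪ N A) (A ∪ N A)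
        (Set.union_subset_union_left _ Set.inter_subset_right)
      rw [h1] at h4
      exact_mod_cast h3.trans h4
  have hJI : (J \ I).ncard ≤ ∑ A ∈ P, (N A).ncard := by
    have : J \ I ⊆ ⋃ A ∈ P, N A := by
      intro e he
      obtain ⟨A, hA, h⟩ := hspan' e he.1 he.2
      exact Set.mem_biUnion hA ⟨he.1, he.2, h⟩
    exact (Set.ncard_le_ncard this).trans (Finset.set_ncard_biUnion_le P N)
  have hIJ : ∑ A ∈ P, (A \ J).ncard ≤ (I \ J).ncard := by
    have : ∀ Q : Finset (Set E), Q ⊆ P →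
        ∑ A ∈ Q, (A \ J).ncard = (⋃ A ∈ Q, (A \ J)).ncard := by
      intro Q
      induction Q using Finset.induction_on with
      | empty => intro _; simp
      | insert B Q hB ih =>
        intro hQ
        rw [Finset.sum_insert hB, ih (fun x hx => hQ (Finset.mem_insert_of_mem hx)),
          Finset.set_biUnion_insert, Set.ncard_union_eq]
        rw [Set.disjoint_iUnion₂_right]
        intro A hA
        refine (hdisj B (hQ (Finset.mem_insert_self _ _)) A
          (hQ (Finset.mem_insert_of_mem hA)) ?_).mono Set.sdiff_subset Set.sdiff_subset
        rintro rfl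
        exact hB hA
    rw [this P subset_rfl]
    refine Set.ncard_le_ncard (Set.iUnion₂_subset fun A hA => ?_)
    exact Set.sdiff_subset_sdiff_left ((hP A).1 hA).prop.1
  have hsum : ∑ A ∈ P, (N A).ncard ≤ ∑ A ∈ P, (A \ J).ncard := by
    refine Finset.sum_le_sum fun A hA => ?_
    have h1 := hkey A hA
    have h2 := Set.ncard_inter_add_ncard_sdiff_eq_ncard A J
    rw [Set.inter_comm] at h2
    omega
  have h1 := Set.ncard_inter_add_ncard_sdiff_eq_ncard I J
  have h2 := Set.ncard_inter_add_ncard_sdiff_eq_ncard J I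
  rw [Set.inter_comm] at h2
  omega

/-- The matroid `M_f` induced by a monotone submodular function `f`. -/
def inducedMatroid {E : Type*} [Finite E] (f : MonotoneSubmodular E) : Matroid E :=
  (IndepMatroid.ofFinite (Set.toFinite Set.univ) (InducedIndep f)
    (fun I hI hne => absurd hne (by simp [Set.subset_empty_iff.1 hI]))
    (fun _ _ hJ hIJ K hK hne => hJ K (hK.trans hIJ) hne)
    (fun _ _ hI hJ hlt => InducedIndep.exists_insert f hI hJ hlt)
    (fun _ _ => Set.subset_univ _)).matroid

/-- The rank of `F` in a matroid on a finite set, as an integer. -/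
noncomputable def matroidRank {E : Type*} (M : Matroid E) (F : Set E) : ℤ :=
  ((M.eRk F).toNat : ℤ)

theorem matroidRank_mono {E : Type*} [Finite E] (M : Matroid E) (A B : Set E) (h : A ⊆ B) :
    matroidRank M A ≤ matroidRank M B := by
  have hB : M.eRk B ≠ ⊤ := ne_top_of_le_ne_top
    (Set.encard_ne_top_iff.2 (Set.toFinite B)) (M.eRk_le_encard B)
  have h1 := ENat.toNat_le_toNat (M.eRk_mono h) hB
  simp only [matroidRank]
  exact_mod_cast h1

theorem matroidRank_submod {E : Type*} [Finite E] (M : Matroid E) (A B : Set E) :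
    matroidRank M (A ∪ B) + matroidRank M (A ∩ B) ≤ matroidRank M A + matroidRank M B := by
  have hf : ∀ S : Set E, M.eRk S ≠ ⊤ := fun S => ne_top_of_le_ne_top
    (Set.encard_ne_top_iff.2 (Set.toFinite S)) (M.eRk_le_encard S)
  have h := M.eRk_submod A B
  have h := ENat.toNat_le_toNat h (by simp [hf])
  rw [ENat.toNat_add (hf _) (hf _), ENat.toNat_add (hf _) (hf _)] at h
  simp only [matroidRank]
  exact_mod_cast (add_comm _ _).trans_le h

/-- The weak order: every independent set of `N₁` is independent in `N₂`. -/
def WeakLE {E : Type*} (N₁ N₂ : Matroid E) : Prop :=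
  N₁.E = N₂.E ∧ ∀ I, N₁.Indep I → N₂.Indep I

/-- The strict weak order. -/
def WeakLT {E : Type*} (N₁ N₂ : Matroid E) : Prop :=
  WeakLE N₁ N₂ ∧ N₁ ≠ N₂

/-! ### Count matroids -/

/-- The set `V(F)` of vertices that are incident to an edge of `F`. -/
def edgeSupport {V : Type*} (G : SimpleGraph V) (F : Set G.edgeSet) : Set V :=
  {v | ∃ e ∈ F, v ∈ (e : Sym2 V)}

/-- The function `c_{k,l}(F) = k |V(F)| - l`. -/
noncomputable def countFunction {V : Type*} [Finite V] (G : SimpleGraph V) (k l : ℕ) :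
    MonotoneSubmodular G.edgeSet where
  toFun F := k * (edgeSupport G F).ncard - l
  mono A B h := by
    have : (edgeSupport G A).ncard ≤ (edgeSupport G B).ncard :=
      Set.ncard_le_ncard (fun v ⟨e, he, hv⟩ => ⟨e, h he, hv⟩)
    gcongr
  submod A B := by
    have h1 : edgeSupport G (A ∪ B) = edgeSupport G A ∪ edgeSupport G B := by
      ext v; simp only [edgeSupport, Set.mem_ofPred_eq, Set.mem_union]; grind
    have h2 : (edgeSupport G (A ∩ B)).ncard ≤ (edgeSupport G A ∩ edgeSupport G B).ncard :=
      Set.ncard_le_ncard (fun v ⟨e, he, hv⟩ => ⟨⟨e, he.1, hv⟩, ⟨e, he.2, hv⟩⟩)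
    have h3 := Set.ncard_union_add_ncard_inter (edgeSupport G A) (edgeSupport G B)
    rw [← h1] at h3
    have h4 : (edgeSupport G (A ∪ B)).ncard + (edgeSupport G (A ∩ B)).ncard ≤
      (edgeSupport G A).ncard + (edgeSupport G B).ncard := by omega
    have h5 : (k : ℤ) * ((edgeSupport G (A ∪ B)).ncard + (edgeSupport G (A ∩ B)).ncard) ≤
      k * ((edgeSupport G A).ncard + (edgeSupport G B).ncard) :=
      mul_le_mul_of_nonneg_left (by exact_mod_cast h4) (Int.natCast_nonneg k)
    linarith

/-- The `(k,l)`-count matroid of `G`, on the edge set of `G`. It is the graphic matroid for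
`(k,l) = (1,1)` and the bicircular matroid for `(k,l) = (1,0)`. -/
noncomputable def countMatroid {V : Type*} [Finite V] (G : SimpleGraph V) (k l : ℕ) :
    Matroid G.edgeSet :=
  inducedMatroid (countFunction G k l)

/-! ### Hadamard products and algebraic matroids -/

/-- Closure in the Zariski topology of `ℂ^ι`. -/
def zariskiClosure {ι : Type*} (S : Set (ι → ℂ)) : Set (ι → ℂ) :=
  zeroLocus ℂ (vanishingIdeal ℂ S)

/-- `V` is Zariski closed and irreducible. -/
def IsIrreducibleVariety {ι : Type*} (V : Set (ι → ℂ)) : Prop :=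
  zariskiClosure V = V ∧ (vanishingIdeal ℂ V).IsPrime

theorem vanishingIdeal_zariskiClosure {ι : Type*} (S : Set (ι → ℂ)) :
    vanishingIdeal ℂ (zariskiClosure S) = vanishingIdeal ℂ S :=
  le_antisymm (vanishingIdeal_anti_mono (zeroLocus_vanishingIdeal_le S))
    (le_vanishingIdeal_zeroLocus _)

theorem zariskiClosure_eq_univ_iff {ι : Type*} (S : Set (ι → ℂ)) :
    zariskiClosure S = Set.univ ↔ ∀ p : MvPolynomial ι ℂ, (∀ x ∈ S, aeval x p = 0) → p = 0 := by
  constructor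
  · intro h p hp
    have h1 : p ∈ vanishingIdeal ℂ (zariskiClosure S) := by
      rw [vanishingIdeal_zariskiClosure]; exact hp
    rw [h] at h1
    refine MvPolynomial.funext fun x => ?_
    have := h1 x (Set.mem_univ x)
    rw [map_zero]
    rwa [aeval_eq_eval] at this
  · intro h
    refine Set.eq_univ_of_forall fun x p hp => ?_
    rw [h p hp, map_zero]

/-- `I` belongs to `I_V` if the coordinate projection of `V` to `ℂ^I` is Zariski dense. -/
def AlgIndep {ι : Type*} (V : Set (ι → ℂ)) (I : Set ι) : Prop :=
  zariskiClosure ((fun x : ι → ℂ => I.domRestrict x) '' V) = Set.univ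

theorem exists_algebraicMatroid {ι : Type*} (V : Set (ι → ℂ)) (hV : IsIrreducibleVariety V) :
    ∃ M : Matroid ι, Set.univ = M.E ∧ ∀ I, M.Indep I ↔ AlgIndep V I := by
  have := hV.2
  let A := MvPolynomial ι ℂ ⧸ vanishingIdeal ℂ V
  have hdom : IsDomain A := Ideal.Quotient.isDomain _
  have hinj : FaithfulSMul ℂ A :=
    (faithfulSMul_iff_algebraMap_injective ℂ A).2 (algebraMap ℂ A).injective
  let c : ι → A := fun i => Ideal.Quotient.mk _ (X i)
  refine ⟨(AlgebraicIndependent.matroid ℂ A).comap c, by simp, fun I => ?_⟩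
  have h1 : (AlgebraicIndepOn ℂ id (c '' I) ∧ Set.InjOn c I) ↔
      AlgebraicIndependent ℂ (fun i : I => c i) := by
    constructor
    · rintro ⟨h, hinj⟩
      exact (h.comp (fun i : I => (⟨c i, i, i.2, rfl⟩ : c '' I))
        (fun i j hij => Subtype.ext (hinj i.2 j.2 (congrArg Subtype.val hij))) :)
    · intro h
      have hinj : Set.InjOn c I := fun i hi j hj hij =>
        congrArg Subtype.val (h.injective (a₁ := ⟨i, hi⟩) (a₂ := ⟨j, hj⟩) hij)
      refine ⟨?_, hinj⟩
      have := h.coe_range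
      rw [← Set.image_eq_range] at this
      exact this
  rw [Matroid.comap_indep_iff, AlgebraicIndependent.matroid_indep_iff, h1, AlgIndep,
    zariskiClosure_eq_univ_iff, algebraicIndependent_iff]
  refine forall_congr' fun p => imp_congr ?_ Iff.rfl
  have h2 : aeval (fun i : I => c i) p =
      Ideal.Quotient.mk (vanishingIdeal ℂ V) (rename (fun i : I => (i : ι)) p) := by
    have : aeval (fun i : I => c i) =
        (Ideal.Quotient.mkₐ ℂ (vanishingIdeal ℂ V)).comp (rename (fun i : I => (i : ι))) := by
      ext i; simp [c]
    rw [this]; rfl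
  rw [h2, Ideal.Quotient.eq_zero_iff_mem, mem_vanishingIdeal_iff]
  simp only [Set.forall_mem_image, aeval_rename]
  rfl

/-- The algebraic matroid `M(V)` of an irreducible variety `V`. -/
noncomputable def algebraicMatroid {ι : Type*} (V : Set (ι → ℂ)) (hV : IsIrreducibleVariety V) :
    Matroid ι :=
  Matroid.ofExistsMatroid Set.univ (AlgIndep V) (exists_algebraicMatroid V hV)

/-- The Hadamard product `X₁ * ⋯ * X_d`: the Zariski closure of the set of coordinatewise
products. -/
def hadamardProduct {ι : Type*} {d : ℕ} (X : Fin d → Set (ι → ℂ)) : Set (ι → ℂ) :=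
  zariskiClosure {z | ∃ x : Fin d → ι → ℂ, (∀ i, x i ∈ X i) ∧ z = fun j => ∏ i, x i j}

/-- A nonempty set whose points are joined within the set by polynomial curves has prime
vanishing ideal. -/
theorem isPrime_vanishingIdeal_of_curves {ι : Type*} (S : Set (ι → ℂ)) (hne : S.Nonempty)
    (h : ∀ x ∈ S, ∀ y ∈ S, ∃ γ : ι → Polynomial ℂ,
      (∀ t : ℂ, (fun i => (γ i).eval t) ∈ S) ∧ (∀ i, (γ i).eval 0 = x i) ∧
        (∀ i, (γ i).eval 1 = y i)) :
    (vanishingIdeal ℂ S).IsPrime := by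
  refine ⟨?_, ?_⟩
  · intro htop
    obtain ⟨x, hx⟩ := hne
    have h1 : (1 : MvPolynomial ι ℂ) ∈ vanishingIdeal ℂ S := by rw [htop]; trivial
    simpa using h1 x hx
  · intro p q hpq
    by_contra hcon
    push Not at hcon
    obtain ⟨hp, hq⟩ := hcon
    simp only [mem_vanishingIdeal_iff, not_forall] at hp hq
    obtain ⟨x, hx, hpx⟩ := hp
    obtain ⟨y, hy, hqy⟩ := hq
    obtain ⟨γ, hγ, h0, h1⟩ := h x hx y hy
    have key : ∀ (r : MvPolynomial ι ℂ) (t : ℂ),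
        (aeval γ r).eval t = aeval (fun i => (γ i).eval t) r := by
      intro r t
      have : (Polynomial.aeval t).comp (aeval γ) =
          (aeval (fun i => (γ i).eval t) : MvPolynomial ι ℂ →ₐ[ℂ] ℂ) := by
        ext i; simp [Polynomial.aeval_def, Polynomial.eval₂_eq_eval_map]
      have := DFunLike.congr_fun this r
      simpa using this
    have hz : aeval γ p * aeval γ q = 0 := by
      refine Polynomial.funext fun t => ?_
      rw [← map_mul, key, Polynomial.eval_zero]
      exact hpq _ (hγ t)
    rcases mul_eq_zero.1 hz with hz | hz
    · apply hpx
      have := key p 0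
      rw [hz, Polynomial.eval_zero, funext h0] at this
      exact this.symm
    · apply hqy
      have := key q 1
      rw [hz, Polynomial.eval_zero, funext h1] at this
      exact this.symm

theorem isIrreducibleVariety_hadamardProduct {ι : Type*} {d : ℕ}
    (L : Fin d → Submodule ℂ (ι → ℂ)) :
    IsIrreducibleVariety (hadamardProduct (fun i => (L i : Set (ι → ℂ)))) := by
  refine ⟨?_, ?_⟩
  · rw [hadamardProduct]
    conv_lhs => rw [zariskiClosure, vanishingIdeal_zariskiClosure]
    rfl
  · rw [hadamardProduct, vanishingIdeal_zariskiClosure]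
    refine isPrime_vanishingIdeal_of_curves _ ⟨_, fun _ => 0, fun i => (L i).zero_mem, rfl⟩ ?_
    rintro _ ⟨x, hx, rfl⟩ _ ⟨y, hy, rfl⟩
    refine ⟨fun j => ∏ i, (Polynomial.C (x i j) +
      Polynomial.X * Polynomial.C (y i j - x i j)), fun t => ?_, fun j => ?_, fun j => ?_⟩
    · refine ⟨fun i => x i + t • (y i - x i), fun i => ?_, ?_⟩
      · exact (L i).add_mem (hx i) ((L i).smul_mem _ ((L i).sub_mem (hy i) (hx i)))
      · funext j
        simp [Polynomial.eval_prod]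
    · simp [Polynomial.eval_prod]
    · simp [Polynomial.eval_prod]

theorem isIrreducibleVariety_submodule {ι : Type*} [Finite ι] (L : Submodule ℂ (ι → ℂ)) :
    IsIrreducibleVariety (L : Set (ι → ℂ)) := by
  classical
  obtain ⟨_⟩ := nonempty_fintype ι
  refine ⟨Set.Subset.antisymm ?_ (zeroLocus_vanishingIdeal_le _), ?_⟩
  · intro x hx
    by_contra hxL
    obtain ⟨φ, hφ, hL⟩ := Submodule.exists_le_ker_of_notMem (p := L) hxL
    let p : MvPolynomial ι ℂ := ∑ i, C (φ (Pi.single i 1)) * X i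
    have hp : ∀ y : ι → ℂ, aeval y p = φ y := by
      intro y
      have h1 := LinearMap.pi_apply_eq_sum_univ φ y
      simp only [smul_eq_mul] at h1
      simp only [p, map_sum, map_mul, aeval_X, algHom_C]
      rw [h1]
      refine Finset.sum_congr rfl fun i _ => ?_
      rw [mul_comm]
      congr 1
      change φ _ = φ _
      congr 1
      funext j
      simp [Pi.single_apply, eq_comm]
    refine hφ ?_
    rw [← hp]
    exact hx p (fun y hy => by rw [hp]; exact hL hy)
  · refine isPrime_vanishingIdeal_of_curves _ ⟨0, L.zero_mem⟩ fun x hx y hy => ?_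
    refine ⟨fun j => Polynomial.C (x j) + Polynomial.X * Polynomial.C (y j - x j),
      fun t => ?_, fun j => by simp, fun j => by simp⟩
    have : (fun j => (Polynomial.C (x j) +
        Polynomial.X * Polynomial.C (y j - x j)).eval t) = x + t • (y - x) := by
      funext j; simp
    rw [this]
    exact L.add_mem hx (L.smul_mem _ (L.sub_mem hy hx))

/-- The algebraic matroid `M(L)` of a linear space `L`. -/
noncomputable def linearSpaceMatroid {ι : Type*} [Finite ι] (L : Submodule ℂ (ι → ℂ)) :
    Matroid ι :=
  algebraicMatroid (L : Set (ι → ℂ)) (isIrreducibleVariety_submodule L)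

/-- The algebraic matroid `M(L₁ * ⋯ * L_d)` of a Hadamard product of linear spaces. -/
noncomputable def hadamardMatroid {ι : Type*} {d : ℕ} (L : Fin d → Submodule ℂ (ι → ℂ)) :
    Matroid ι :=
  algebraicMatroid (hadamardProduct (fun i => (L i : Set (ι → ℂ))))
    (isIrreducibleVariety_hadamardProduct L)

/-- The function `r₁ + ⋯ + r_d - (d - 1)`, where `r_i` is the rank function of `M(L_i)`. -/
noncomputable def bernsteinFunction {ι : Type*} [Finite ι] {d : ℕ}
    (L : Fin d → Submodule ℂ (ι → ℂ)) : MonotoneSubmodular ι where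
  toFun F := ∑ i, matroidRank (linearSpaceMatroid (L i)) F - ((d : ℤ) - 1)
  mono A B h := by
    have := Finset.sum_le_sum (s := Finset.univ)
      (fun i _ => matroidRank_mono (linearSpaceMatroid (L i)) A B h)
    linarith
  submod A B := by
    have := Finset.sum_le_sum (s := Finset.univ)
      (fun i _ => matroidRank_submod (linearSpaceMatroid (L i)) A B)
    rw [Finset.sum_add_distrib, Finset.sum_add_distrib] at this
    linarith

/-- The matrix `A` represents `N` as a row matroid. -/
def RepresentsRows {E : Type*} {n : ℕ} (A : Matrix E (Fin n) ℂ) (N : Matroid E) : Prop :=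
  N.E = Set.univ ∧ ∀ I : Set E, N.Indep I ↔ LinearIndependent ℂ (fun e : I => A.row e)

/-- The column space of a matrix. -/
def columnSpace {E : Type*} {n : ℕ} (A : Matrix E (Fin n) ℂ) : Submodule ℂ (E → ℂ) :=
  Submodule.span ℂ (Set.range A.col)

/-! ### The graph -/

/-- A cyclic chain of four copies of `K₆` minus an edge. The vertices `(i, 0)` are four hubs. For
each `i` (mod 4) the six vertices `(i, 0), …, (i, 4), (i + 1, 0)` span a `K₆` minus the edge
joining the two hubs `(i, 0)` and `(i + 1, 0)`; there are no other edges. -/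
def hubGraph : SimpleGraph (Fin 4 × Fin 5) where
  Adj p q := (p.1 = q.1 ∧ p.2 ≠ q.2) ∨ (q.1 = p.1 + 1 ∧ p.2 ≠ 0 ∧ q.2 = 0) ∨
    (p.1 = q.1 + 1 ∧ q.2 ≠ 0 ∧ p.2 = 0)
  symm := ⟨fun p q h => by
    rcases h with h | h | h
    · exact Or.inl ⟨h.1.symm, h.2.symm⟩
    · exact Or.inr (Or.inr h)
    · exact Or.inr (Or.inl h)⟩
  loopless := ⟨fun p h => by
    rcases h with h | h | h
    · exact h.2 rfl
    · exact h.2.1 h.2.2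
    · exact h.2.1 h.2.2⟩

/-! ### Independence and rank in the matroids of the statement -/

/-! The expected rank subtracts one scalar for each of the two redundant rescalings of `L₀ * L₁ *
L₂`, applied to all of `E` at once. The counterexample exploits that more scaling is redundant than
that. Divide `E` into blocks. On one block, the product of a point of `L₀` and a point of `L₁` is
determined by the two projective points and one scalar, so the restriction of `L₀ * L₁` to it costs
at most `(r₀ - 1) + (r₁ - 1) + 1`, with ranks taken on the block. Treating `L₂` globally and
absorbing its scalar into the block scalars adds only `r₂(E) - 1`. This is
`ncard_le_of_algIndep_hadamardProduct`; with a single block it gives the bound `r₀ + r₁ + r₂ - 2`,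
hence the weak order inequality `hadamardMatroid_weakLE`.

For the four blocks of `hubGraph`, each on 6 vertices, the graphic rank of a block is at most 5 and
the bicircular rank of `E` is at most 20. The bound is `4 * 4 + 4 * 4 + 4 + 19 = 55`, while `|E| =
56`. So `E` is dependent in the Hadamard matroid.

On the other side, `E` is independent in the `(3,4)`-count matroid
(`count_three_four_indep_hubGraph`): each block is tight, and closing four blocks into a cycle at
four hubs loses `4 * 4` and regains `3 * 4`, leaving exactly 4. Independence then passes to the
matroid induced by `2 r₁₁ + r₁₀ - 2` by `ncard_le_of_count_three_four_indep`: on a connected set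
that is not a tree, on `v` vertices, this function is at least `2 (v - 1) + v - 2 = 3 v - 4`, and
trees and disconnected sets have room to spare. Both matroids are therefore free on `E`, hence
equal, of rank 56. -/

theorem inducedMatroid_indep_iff {E : Type*} [Finite E] (f : MonotoneSubmodular E) (F : Set E) :
    (inducedMatroid f).Indep F ↔ InducedIndep f F := by
  rw [inducedMatroid, IndepMatroid.matroid_indep_iff]
  exact iff_of_eq (congrFun (IndepMatroid.ofFinite_indep _ _ _ _ _ _) F)

theorem countMatroid_indep_iff {V : Type*} [Finite V] (G : SimpleGraph V) (k l : ℕ)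
    (F : Set G.edgeSet) :
    (countMatroid G k l).Indep F ↔ ∀ I ⊆ F, I.Nonempty →
      (I.ncard : ℤ) ≤ k * (edgeSupport G I).ncard - l :=
  inducedMatroid_indep_iff _ F

theorem Matroid.Indep.ncard_le_matroidRank {E : Type*} [Finite E] {M : Matroid E} {I X : Set E}
    (hI : M.Indep I) (hIX : I ⊆ X) : (I.ncard : ℤ) ≤ matroidRank M X := by
  have hX : M.eRk X ≠ ⊤ := ne_top_of_le_ne_top
    (Set.encard_ne_top_iff.2 (Set.toFinite X)) (M.eRk_le_encard X)
  have h := ENat.toNat_le_toNat (hI.encard_le_eRk_of_subset hIX) hX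
  simp only [matroidRank]
  exact_mod_cast h

theorem exists_indep_ncard_eq_matroidRank {E : Type*} (M : Matroid E) (X : Set E) :
    ∃ I ⊆ X, M.Indep I ∧ (I.ncard : ℤ) = matroidRank M X := by
  obtain ⟨I, hI⟩ := M.exists_isBasis' X
  refine ⟨I, hI.subset, hI.indep, ?_⟩
  rw [matroidRank, ← hI.encard_eq_eRk]
  rfl

theorem algebraicMatroid_indep_iff {ι : Type*} (V : Set (ι → ℂ)) (hV : IsIrreducibleVariety V)
    (I : Set ι) : (algebraicMatroid V hV).Indep I ↔ AlgIndep V I := by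
  simp [algebraicMatroid, Matroid.ofExistsMatroid]

theorem algIndep_iff {ι : Type*} (V : Set (ι → ℂ)) (I : Set ι) :
    AlgIndep V I ↔ ∀ p : MvPolynomial I ℂ, (∀ x ∈ V, aeval (fun i : I => x i) p = 0) → p = 0 := by
  rw [AlgIndep, zariskiClosure_eq_univ_iff]
  refine forall_congr' fun p => ?_
  rw [Set.forall_mem_image]
  rfl

/-! ### Algebraic matroids of linear spaces -/

/-- The coordinate functionals of a linear space. -/
def coordFunctional {ι : Type*} (L : Submodule ℂ (ι → ℂ)) (e : ι) : L →ₗ[ℂ] ℂ :=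
  (LinearMap.proj e).comp L.subtype

theorem coordFunctional_apply {ι : Type*} (L : Submodule ℂ (ι → ℂ)) (e : ι) (x : L) :
    coordFunctional L e x = (x : ι → ℂ) e := rfl

/-- The projection of `L` to `ℂ^I` is a linear subspace. If the functionals are independent it is
everything, since no nonzero linear form vanishes on it; a dependence is itself a linear polynomial
that vanishes on it. -/
theorem algIndep_submodule_iff {ι : Type*} [Finite ι] (L : Submodule ℂ (ι → ℂ)) (I : Set ι) :
    AlgIndep (L : Set (ι → ℂ)) I ↔ LinearIndepOn ℂ (coordFunctional L) I := by
  classical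
  obtain ⟨_⟩ := nonempty_fintype I
  rw [algIndep_iff]
  constructor
  · intro h
    refine Fintype.linearIndependent_iff.2 fun g hg i => ?_
    have h1 : (∑ j : I, C (g j) * X j : MvPolynomial I ℂ) = 0 := by
      refine h _ fun x hx => ?_
      have h2 := LinearMap.congr_fun hg ⟨x, hx⟩
      simpa [coordFunctional_apply] using h2
    have h2 := congrArg (eval (Pi.single i (1 : ℂ))) h1
    simpa [Pi.single_apply] using h2
  · intro h p hp
    let R : L →ₗ[ℂ] (I → ℂ) := LinearMap.pi fun i => coordFunctional L i
    have hR : ∀ y, y ∈ LinearMap.range R := by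
      intro y
      by_contra hy
      obtain ⟨φ, hφ, hle⟩ := Submodule.exists_le_ker_of_notMem hy
      have hsum : ∀ z, φ z = ∑ i, z i * φ (Pi.single i 1) := fun z => by
        conv_lhs => rw [← LinearMap.sum_single_apply (fun _ : I => ℂ) z]
        rw [map_sum]
        refine Finset.sum_congr rfl fun i _ => ?_
        rw [← smul_eq_mul, ← map_smul, ← Pi.single_smul]
        simp
      have h0 := Fintype.linearIndependent_iff.1 h (fun i => φ (Pi.single i 1)) (by
        ext x
        have h1 : φ (R x) = 0 := hle ⟨x, rfl⟩
        rw [hsum] at h1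
        simpa [R, mul_comm] using h1)
      exact hφ (by rw [hsum]; simp [h0])
    refine MvPolynomial.funext fun y => ?_
    obtain ⟨x, rfl⟩ := hR y
    have := hp x x.2
    rw [map_zero]
    rwa [aeval_eq_eval] at this

/-- A relation among rows says that a linear form vanishes on every column, hence on the span of the
columns; so rows and coordinate functionals satisfy the same relations. -/
theorem linearIndependent_rows_iff_coordFunctional {E : Type*} [Finite E] {n : ℕ}
    (A : Matrix E (Fin n) ℂ) (I : Set E) :
    LinearIndependent ℂ (fun e : I => A.row e) ↔
      LinearIndepOn ℂ (coordFunctional (columnSpace A)) I := by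
  obtain ⟨_⟩ := nonempty_fintype I
  rw [LinearIndepOn, Fintype.linearIndependent_iff, Fintype.linearIndependent_iff]
  refine forall_congr' fun g => imp_congr ?_ Iff.rfl
  constructor
  · intro h
    ext ⟨x, hx⟩
    simp only [LinearMap.coe_sum, Finset.sum_apply, LinearMap.smul_apply, coordFunctional_apply,
      LinearMap.zero_apply]
    induction hx using Submodule.span_induction with
    | mem x hx =>
      obtain ⟨k, rfl⟩ := hx
      simpa using congrFun h k
    | zero => simp
    | add x y _ _ hx hy =>
      simp only [Pi.add_apply, smul_add, Finset.sum_add_distrib, hx, hy, add_zero]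
    | smul a x _ hx =>
      simp only [Pi.smul_apply, smul_comm _ a, ← Finset.smul_sum, hx, smul_zero]
  · intro h
    ext k
    have := LinearMap.congr_fun h ⟨A.col k, Submodule.subset_span ⟨k, rfl⟩⟩
    simpa [coordFunctional_apply] using this

/-- The algebraic matroid of the column space of a matrix is its row matroid. -/
theorem RepresentsRows.linearSpaceMatroid_columnSpace {E : Type*} [Finite E] {n : ℕ}
    {A : Matrix E (Fin n) ℂ} {N : Matroid E} (h : RepresentsRows A N) :
    linearSpaceMatroid (columnSpace A) = N := by
  refine Matroid.ext_indep h.1.symm fun I _ => ?_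
  rw [h.2, linearSpaceMatroid, algebraicMatroid_indep_iff, algIndep_submodule_iff,
    linearIndependent_rows_iff_coordFunctional]

theorem linearSpaceMatroid_indep_iff {ι : Type*} [Finite ι] (L : Submodule ℂ (ι → ℂ))
    (I : Set ι) : (linearSpaceMatroid L).Indep I ↔ LinearIndepOn ℂ (coordFunctional L) I := by
  rw [linearSpaceMatroid, algebraicMatroid_indep_iff, algIndep_submodule_iff]

theorem linearSpaceMatroid_indep_singleton_iff {ι : Type*} [Finite ι] (L : Submodule ℂ (ι → ℂ))
    (e : ι) : (linearSpaceMatroid L).Indep {e} ↔ ∃ x ∈ L, x e ≠ 0 := by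
  rw [linearSpaceMatroid_indep_iff, linearIndepOn_singleton_iff]
  constructor
  · intro h
    by_contra! hcon
    exact h (LinearMap.ext fun x => hcon x x.2)
  · rintro ⟨x, hx, hxe⟩ h
    exact hxe (LinearMap.congr_fun h ⟨x, hx⟩)

/-- On a set `J` containing `e`, the coordinates of the points of `L` are linear functions of the
`e`-th coordinate and of fewer than `r(J)` others. -/
theorem exists_coordinates_of_linearSpace {ι : Type*} [Finite ι] (L : Submodule ℂ (ι → ℂ))
    (J : Set ι) (e : ι) (he : e ∈ J) (hL : ∃ x ∈ L, x e ≠ 0) :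
    ∃ s : Finset ι, (s.card : ℤ) ≤ matroidRank (linearSpaceMatroid L) J - 1 ∧
      ∃ (u₀ : ι → ℂ) (u : ι → ι → ℂ), ∀ x ∈ L, ∀ j ∈ J,
        x j = x e * u₀ j + ∑ k ∈ s, x k * u k j := by
  classical
  rw [← linearSpaceMatroid_indep_singleton_iff, linearSpaceMatroid_indep_iff] at hL
  -- The basis of the functionals on `J` is grown from `{e}`, so that it contains `e`; splitting `e`
  -- off leaves at most `r(J) - 1` others.
  obtain ⟨b, hbJ, heb, hspan, hb⟩ :=
    exists_linearIndepOn_extension hL (Set.singleton_subset_iff.2 he)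
  have heb : e ∈ b := heb rfl
  obtain ⟨t, rfl⟩ := b.toFinite.exists_finset_coe
  have hex : ∀ j, ∃ c : ι → ℂ, j ∈ J →
      ∑ k ∈ t, c k • coordFunctional L k = coordFunctional L j := by
    intro j
    by_cases hj : j ∈ J
    · obtain ⟨c, hc⟩ := (Submodule.mem_span_image_finset_iff_exists_fun ℂ).1 (hspan ⟨j, hj, rfl⟩)
      refine ⟨fun k => if h : k ∈ t then c ⟨k, h⟩ else 0, fun _ => ?_⟩
      rw [← hc, ← Finset.sum_coe_sort]
      simp
    · exact ⟨0, fun h => absurd h hj⟩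
  choose c hc using hex
  refine ⟨t.erase e, ?_, fun j => c j e, fun k j => c j k, fun x hx j hj => ?_⟩
  · have h1 := ((linearSpaceMatroid_indep_iff L _).2 hb).ncard_le_matroidRank hbJ
    rw [Set.ncard_coe_finset] at h1
    have h2 := Finset.card_erase_add_one (Finset.mem_coe.1 heb)
    omega
  · have h1 := LinearMap.congr_fun (hc j hj) ⟨x, hx⟩
    simp only [LinearMap.coe_sum, Finset.sum_apply, LinearMap.smul_apply, coordFunctional_apply,
      smul_eq_mul] at h1
    rw [← h1, ← Finset.add_sum_erase t _ (Finset.mem_coe.1 heb), mul_comm (c j e)]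
    simp only [mul_comm (c j _)]

/-! ### Dimension bounds for Hadamard products -/

/-- More polynomials than variables are algebraically dependent. -/
theorem exists_ne_zero_aeval_eq_zero_of_card_lt {σ κ : Type*} [Finite σ] [Finite κ]
    (h : Nat.card σ < Nat.card κ) (φ : κ → MvPolynomial σ ℂ) :
    ∃ p : MvPolynomial κ ℂ, p ≠ 0 ∧ aeval φ p = 0 := by
  by_contra! hcon
  have hφ : AlgebraicIndependent ℂ φ :=
    algebraicIndependent_iff.2 fun p hp => by_contra fun h0 => hcon p h0 hp
  have h1 := hφ.lift_cardinalMk_le_trdeg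
  rw [MvPolynomial.trdeg_of_isDomain, ← Nat.cast_card (α := σ), ← Nat.cast_card (α := κ)] at h1
  simp only [Cardinal.lift_natCast, Nat.cast_le] at h1
  omega

theorem aeval_eq_zero_of_forall_eval {σ κ : Type*} {φ : κ → MvPolynomial σ ℂ}
    {p : MvPolynomial κ ℂ} (hp : aeval φ p = 0) {t : σ → ℂ} {z : κ → ℂ}
    (h : ∀ j, eval t (φ j) = z j) : aeval z p = 0 := by
  have h1 : (aeval t : MvPolynomial σ ℂ →ₐ[ℂ] ℂ).comp (aeval φ) = aeval z := by
    ext j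
    simpa [aeval_eq_eval] using h j
  rw [← h1, AlgHom.comp_apply, hp, map_zero]

/-- If `J` is independent in `M(L₀ * L₁ * L₂)` and is divided into blocks, then `L₀` and `L₁` may
be rescaled on each block separately and `L₂` may be rescaled on `J`, so that only the projective
dimensions of these spaces, and a scalar for each block, contribute to a bound for `|J|`. -/
theorem ncard_le_of_algIndep_hadamardProduct {ι β : Type*} [Finite ι] [Fintype β] [Nonempty β]
    (L : Fin 3 → Submodule ℂ (ι → ℂ)) (hL : ∀ i e, ∃ x ∈ L i, x e ≠ 0) (J : Set ι)
    (hJ : AlgIndep (hadamardProduct fun i => (L i : Set (ι → ℂ))) J) (b : ι → β) (r : β → ι)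
    (hrJ : ∀ i, r i ∈ J) (hbr : ∀ i, b (r i) = i) :
    (J.ncard : ℤ) ≤ ∑ i, (matroidRank (linearSpaceMatroid (L 0)) (J ∩ b ⁻¹' {i}) - 1) +
      ∑ i, (matroidRank (linearSpaceMatroid (L 1)) (J ∩ b ⁻¹' {i}) - 1) + Fintype.card β +
      (matroidRank (linearSpaceMatroid (L 2)) J - 1) := by
  classical
  obtain ⟨i₀⟩ := ‹Nonempty β›
  have hr : ∀ i, r i ∈ J ∩ b ⁻¹' {i} := fun i => ⟨hrJ i, hbr i⟩
  choose s hs u₀ u hu using fun i =>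
    exists_coordinates_of_linearSpace (L 0) (J ∩ b ⁻¹' {i}) (r i) (hr i) (hL 0 _)
  choose s' hs' v₀ v hv using fun i =>
    exists_coordinates_of_linearSpace (L 1) (J ∩ b ⁻¹' {i}) (r i) (hr i) (hL 1 _)
  obtain ⟨s'', hs'', w₀, w, hw⟩ :=
    exists_coordinates_of_linearSpace (L 2) J (r i₀) (hrJ i₀) (hL 2 _)
  by_contra! hlt
  -- Parameters: affine coordinates of `L 0` and of `L 1` on each block, one scalar for each block,
  -- and affine coordinates of `L 2` on `J`.
  let σ := ((Σ i, s i) ⊕ (Σ i, s' i)) ⊕ (β ⊕ s'')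
  have hcard : Nat.card σ < Nat.card J := by
    have h1 : Nat.card σ = ∑ i, (s i).card + ∑ i, (s' i).card + (Fintype.card β + s''.card) := by
      simp [σ]
    have h2 := Finset.sum_le_sum (s := Finset.univ) fun i _ => hs i
    have h3 := Finset.sum_le_sum (s := Finset.univ) fun i _ => hs' i
    rw [h1, Nat.card_coe_set_eq]
    zify
    linarith
  let φ : J → MvPolynomial σ ℂ := fun j =>
    (C (u₀ (b j) j) + ∑ k : s (b j), X (Sum.inl (Sum.inl ⟨b j, k⟩)) * C (u (b j) k j)) *
    (C (v₀ (b j) j) + ∑ k : s' (b j), X (Sum.inl (Sum.inr ⟨b j, k⟩)) * C (v (b j) k j)) *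
    X (Sum.inr (Sum.inl (b j))) *
    (C (w₀ j) + ∑ k : s'', X (Sum.inr (Sum.inr k)) * C (w k j))
  obtain ⟨p, hp0, hp⟩ := exists_ne_zero_aeval_eq_zero_of_card_lt hcard φ
  -- The parametrization `φ` reaches only products that are nonzero at every `r i`, where the
  -- factors can be normalized. The extra factor makes the polynomial vanish at the remaining
  -- products too.
  have hq : p * ∏ i, X (⟨r i, hrJ i⟩ : J) = 0 := by
    have hS := (algIndep_iff _ _).1 hJ (p * ∏ i, X (⟨r i, hrJ i⟩ : J))
    have hvan : rename (fun j : J => (j : ι)) (p * ∏ i, X (⟨r i, hrJ i⟩ : J)) ∈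
        vanishingIdeal ℂ
          {z | ∃ x : Fin 3 → ι → ℂ, (∀ i, x i ∈ L i) ∧ z = fun j => ∏ i, x i j} := by
      rintro _ ⟨x, hx, rfl⟩
      rw [aeval_rename, map_mul, map_prod]
      simp only [aeval_X, Function.comp_apply]
      by_cases hz : ∏ i, ∏ k, x k (r i) = 0
      · rw [hz, mul_zero]
      · have hne : ∀ k i, x k (r i) ≠ 0 := fun k i h =>
          hz (Finset.prod_eq_zero (Finset.mem_univ i) (Finset.prod_eq_zero (Finset.mem_univ k) h))
        -- The scalar of block `i` collects the values divided out: those of `x 0` and `x 1` at `r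
        -- i`, and that of `x 2` at the single point `r i₀`.
        let t : σ → ℂ := Sum.elim
          (Sum.elim (fun k => x 0 k.2 / x 0 (r k.1)) (fun k => x 1 k.2 / x 1 (r k.1)))
          (Sum.elim (fun i => x 0 (r i) * x 1 (r i) * x 2 (r i₀)) (fun k => x 2 k / x 2 (r i₀)))
        rw [aeval_eq_zero_of_forall_eval (t := t) hp, zero_mul]
        intro j
        have h0 := hu (b j) (x 0) (hx 0) j ⟨j.2, rfl⟩
        have h1 := hv (b j) (x 1) (hx 1) j ⟨j.2, rfl⟩
        have h2 := hw (x 2) (hx 2) j j.2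
        have a0 := hne 0 (b j)
        have a1 := hne 1 (b j)
        have a2 := hne 2 i₀
        simp only [φ, t, map_mul, map_add, map_sum, eval_C, eval_X, Sum.elim_inl, Sum.elim_inr,
          Function.comp_apply, Fin.prod_univ_three]
        rw [h0, h1, h2]
        rw [Finset.sum_coe_sort (s (b j)) fun k => x 0 k / x 0 (r (b j)) * u (b j) k j,
          Finset.sum_coe_sort (s' (b j)) fun k => x 1 k / x 1 (r (b j)) * v (b j) k j,
          Finset.sum_coe_sort s'' fun k => x 2 k / x 2 (r i₀) * w k j]
        simp only [div_mul_eq_mul_div, ← Finset.sum_div]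
        field_simp
    refine hS fun z hz => ?_
    rw [hadamardProduct, zariskiClosure] at hz
    have := hz _ hvan
    rwa [aeval_rename] at this
  rcases mul_eq_zero.1 hq with h | h
  · exact hp0 h
  · obtain ⟨i, -, hi⟩ := Finset.prod_eq_zero_iff.1 h
    exact X_ne_zero _ hi

/-! ### Representations of the graphic and the bicircular matroid -/

theorem exists_representsRows_of_vectors {E V : Type*} [Finite V] (N : Matroid E)
    (hN : N.E = Set.univ) (ρ : E → V → ℂ)
    (h : ∀ I : Set E, N.Indep I ↔ LinearIndependent ℂ fun e : I => ρ e) :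
    ∃ (n : ℕ) (A : Matrix E (Fin n) ℂ), RepresentsRows A N := by
  refine ⟨Nat.card V, fun e k => ρ e ((Finite.equivFin V).symm k), hN, fun I => ?_⟩
  rw [h]
  exact (LinearMap.linearIndependent_iff (LinearEquiv.funCongrLeft ℂ ℂ
    (Finite.equivFin V).symm).toLinearMap (LinearEquiv.ker _)).symm

/-- Restriction to `T` is injective on the span, so the restricted vectors stay independent in a
space of dimension `|T|`. This gives the count conditions from linear independence. -/
theorem card_le_of_linearIndependent_of_vanishing {κ V : Type*} [Finite κ] [Finite V]
    {ρ : κ → V → ℂ} (hρ : LinearIndependent ℂ ρ) (T : Set V)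
    (h : ∀ x ∈ Submodule.span ℂ (Set.range ρ), (∀ v ∈ T, x v = 0) → x = 0) :
    Nat.card κ ≤ T.ncard := by
  obtain ⟨_⟩ := nonempty_fintype κ
  obtain ⟨_⟩ := nonempty_fintype T
  have h1 : LinearIndependent ℂ
      (LinearMap.funLeft ℂ ℂ (fun v : T => (v : V)) ∘ ρ) := by
    rw [Fintype.linearIndependent_iff]
    intro g hg
    refine Fintype.linearIndependent_iff.1 hρ g (h _ ?_ fun v hv => ?_)
    · exact Submodule.sum_mem _ fun i _ =>
        Submodule.smul_mem _ _ (Submodule.subset_span ⟨i, rfl⟩)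
    · have := congrFun hg ⟨v, hv⟩
      simpa [LinearMap.funLeft_apply] using this
  have h2 := h1.fintype_card_le_finrank
  rwa [Module.finrank_fintype_fun_eq_card, ← Nat.card_eq_fintype_card,
    ← Nat.card_eq_fintype_card, Nat.card_coe_set_eq T] at h2

/-- Linear combinations of vectors supported on their edges are supported on the vertices of the
edges. -/
theorem span_eq_zero_of_notMem_edgeSupport {V : Type*} (G : SimpleGraph V)
    (ρ : G.edgeSet → V → ℂ) (hρ : ∀ (e : G.edgeSet) (v : V), v ∉ (e : Sym2 V) → ρ e v = 0) (I : Set G.edgeSet)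
    {x : V → ℂ} (hx : x ∈ Submodule.span ℂ (Set.range fun e : I => ρ e)) {v : V}
    (hv : v ∉ edgeSupport G I) : x v = 0 := by
  have : Submodule.span ℂ (Set.range fun e : I => ρ e) ≤
      LinearMap.ker (LinearMap.proj v : (V → ℂ) →ₗ[ℂ] ℂ) := by
    rw [Submodule.span_le]
    rintro _ ⟨e, rfl⟩
    exact hρ e v fun h => hv ⟨e, e.2, h⟩
  exact this hx

theorem linearIndependent_restrict_subset {E M : Type*} [AddCommGroup M] [Module ℂ M] {ρ : E → M}
    {I F : Set E} (h : LinearIndependent ℂ fun e : F => ρ e) (hIF : I ⊆ F) :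
    LinearIndependent ℂ fun e : I => ρ e :=
  LinearIndepOn.mono (v := ρ) h hIF

theorem edge_eq_mk {V : Type*} (G : SimpleGraph V) (e : G.edgeSet) :
    ∃ p : V × V, p.1 ≠ p.2 ∧ (e : Sym2 V) = s(p.1, p.2) := by
  obtain ⟨e, he⟩ := e
  induction e using Sym2.ind with
  | _ a b => exact ⟨(a, b), G.ne_of_adj he, rfl⟩

theorem ncard_mem_edge {V : Type*} (G : SimpleGraph V) (e : G.edgeSet) :
    {v | v ∈ (e : Sym2 V)}.ncard = 2 := by
  obtain ⟨p, hp, he⟩ := edge_eq_mk G e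
  have : {v | v ∈ (e : Sym2 V)} = {p.1, p.2} := by
    ext v
    simp [he]
  rw [this, Set.ncard_pair hp]

/-- The representation is the oriented incidence matrix. -/
theorem exists_represents_graphic {V : Type*} [Finite V] (G : SimpleGraph V) :
    ∃ (n : ℕ) (A : Matrix G.edgeSet (Fin n) ℂ), RepresentsRows A (countMatroid G 1 1) := by
  classical
  obtain ⟨_⟩ := nonempty_fintype V
  choose p hp hep using edge_eq_mk G
  let ρ : G.edgeSet → V → ℂ := fun e => Pi.single (p e).1 1 - Pi.single (p e).2 1
  have hmem : ∀ (e : G.edgeSet) (v : V), v ∈ (e : Sym2 V) ↔ v = (p e).1 ∨ v = (p e).2 := fun e v => by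
    rw [hep e, Sym2.mem_iff]
  have hρ0 : ∀ (e : G.edgeSet) (v : V), v ∉ (e : Sym2 V) → ρ e v = 0 := by
    intro e v hv
    rw [hmem, not_or] at hv
    simp [ρ, hv.1, hv.2]
  have hρ1 : ∀ (e : G.edgeSet) (v : V), v ∈ (e : Sym2 V) → ρ e v ≠ 0 := by
    intro e v hv
    rw [hmem] at hv
    rcases hv with rfl | rfl
    · simp [ρ, hp e]
    · simp [ρ, (hp e).symm]
  refine exists_representsRows_of_vectors _ rfl ρ fun F => ?_
  rw [countMatroid_indep_iff]
  constructor
  · intro hF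
    rw [Fintype.linearIndependent_iff]
    intro g hg
    by_contra! hne
    obtain ⟨i, hi⟩ := hne
    let I : Finset G.edgeSet := Finset.univ.filter fun e => ∃ h : e ∈ F, g ⟨e, h⟩ ≠ 0
    have hI := hF I (fun e he => by
      obtain ⟨h, -⟩ := (Finset.mem_filter.1 (Finset.mem_coe.1 he)).2
      exact h) ⟨i, by simpa [I] using hi⟩
    -- In the support `I` of a linear relation no vertex has degree one, as its coordinate would not
    -- cancel. Double counting incidences gives `|V(I)| ≤ |I|`, against the count.
    have hdc := Finset.card_mul_le_card_mul (s := (edgeSupport G I).toFinset) (t := I)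
      (fun v (e : G.edgeSet) => v ∈ (e : Sym2 V)) (m := 2) (n := 2) ?_ ?_
    · rw [Set.ncard_coe_finset, Set.ncard_eq_toFinset_card'] at hI
      push_cast at hI
      omega
    · intro v hv
      obtain ⟨e, heI, hve⟩ := Set.mem_toFinset.1 hv
      by_contra! hlt
      have huniq : ∀ e' ∈ I, v ∈ (e' : Sym2 V) → e' = e := fun e' he' hv' =>
        Finset.card_le_one.1 (Nat.lt_succ_iff.1 hlt) e'
          (Finset.mem_bipartiteAbove _ |>.2 ⟨he', hv'⟩) e (Finset.mem_bipartiteAbove _ |>.2 ⟨heI, hve⟩)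
      obtain ⟨heF, hge⟩ := (Finset.mem_filter.1 (Finset.mem_coe.1 heI)).2
      have h1 := congrFun hg v
      rw [Finset.sum_apply, Finset.sum_eq_single ⟨e, heF⟩] at h1
      · exact mul_ne_zero hge (hρ1 e v hve) h1
      · rintro ⟨e', he'F⟩ - hne
        by_cases hg' : g ⟨e', he'F⟩ = 0
        · simp [hg']
        · have : v ∉ (e' : Sym2 V) := fun hv' => hne (Subtype.ext
            (huniq e' (Finset.mem_filter.2 ⟨Finset.mem_univ _, he'F, hg'⟩) hv'))
          simp [hρ0 e' v this]
      · simp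
    · intro e _
      rw [← ncard_mem_edge G e, ← Set.ncard_coe_finset]
      exact Set.ncard_le_ncard fun v hv => (Finset.mem_bipartiteBelow _ |>.1 hv).2
  · intro hF I hIF hI
    obtain ⟨e, heI⟩ := hI
    have hv₀ : (p e).1 ∈ edgeSupport G I := ⟨e, heI, (hmem _ _).2 (Or.inl rfl)⟩
    -- Zero coordinate sum lets one vertex of `V(I)` be dropped from the test set, which accounts
    -- for the `-1` of the count.
    have hsum : ∀ x ∈ Submodule.span ℂ (Set.range fun e : I => ρ e), ∑ v, x v = 0 := by
      intro x hx
      induction hx using Submodule.span_induction with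
      | mem x hx =>
        obtain ⟨e, rfl⟩ := hx
        simp [ρ, Finset.sum_sub_distrib]
      | zero => simp
      | add x y _ _ hx hy => simp [Finset.sum_add_distrib, hx, hy]
      | smul a x _ hx => simp [← Finset.mul_sum, hx]
    have h1 := card_le_of_linearIndependent_of_vanishing
      (linearIndependent_restrict_subset hF hIF) (edgeSupport G I \ {(p e).1}) fun x hx hx0 => by
        have h0 : ∀ v, v ≠ (p e).1 → x v = 0 := fun v hv => by
          by_cases hvI : v ∈ edgeSupport G I
          · exact hx0 v ⟨hvI, hv⟩
          · exact span_eq_zero_of_notMem_edgeSupport G ρ hρ0 I hx hvI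
        have h2 := hsum x hx
        rw [Finset.sum_eq_single (p e).1 (fun v _ hv => h0 v hv) (by simp)] at h2
        funext v
        by_cases hv : v = (p e).1
        · rw [hv, h2]; rfl
        · exact h0 v hv
    have h2 := Set.ncard_sdiff_singleton_add_one hv₀
    rw [Nat.card_coe_set_eq] at h1
    push_cast
    omega

/-- The bicircular count is Hall's condition for matching edges to their endpoints. -/
theorem exists_injective_of_bicircular_indep {V : Type*} [Finite V] (G : SimpleGraph V)
    {F : Set G.edgeSet} (hF : (countMatroid G 1 0).Indep F) :
    ∃ m : F → V, Function.Injective m ∧ ∀ e : F, m e ∈ ((e : G.edgeSet) : Sym2 V) := by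
  classical
  obtain ⟨_⟩ := nonempty_fintype V
  rw [countMatroid_indep_iff] at hF
  have := (Finset.all_card_le_biUnion_card_iff_exists_injective
    fun e : F => Finset.univ.filter fun v => v ∈ ((e : G.edgeSet) : Sym2 V)).1 fun s => by
    rcases s.eq_empty_or_nonempty with rfl | hs
    · simp
    · have h := hF ((fun e : F => (e : G.edgeSet)) '' s) (by rintro _ ⟨e, -, rfl⟩; exact e.2)
        (hs.to_set.image _)
      rw [Set.ncard_image_of_injective _ Subtype.val_injective, Set.ncard_coe_finset] at h
      have h1 : edgeSupport G ((fun e : F => (e : G.edgeSet)) '' s) =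
          (s.biUnion fun e : F => Finset.univ.filter fun v => v ∈ ((e : G.edgeSet) : Sym2 V) :
            Finset V) := by
        ext v
        simp [edgeSupport]
      rw [h1, Set.ncard_coe_finset] at h
      push_cast at h
      omega
  simpa using this

/-- The representation is the incidence matrix with generic weights: a matching of an independent
set singles out a square minor that is a nonzero polynomial in the weights, and some choice of
weights keeps all these finitely many minors nonzero. -/
theorem exists_represents_bicircular {V : Type*} [Finite V] (G : SimpleGraph V) :
    ∃ (n : ℕ) (A : Matrix G.edgeSet (Fin n) ℂ), RepresentsRows A (countMatroid G 1 0) := by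
  classical
  obtain ⟨_⟩ := nonempty_fintype V
  choose m hminj hm using fun F : {F // (countMatroid G 1 0).Indep F} =>
    exists_injective_of_bicircular_indep G F.2
  let M : ∀ F : {F // (countMatroid G 1 0).Indep F},
      Matrix F.1 F.1 (MvPolynomial (G.edgeSet × V) ℂ) := fun F e e' =>
    if m F e' ∈ ((e : G.edgeSet) : Sym2 V) then X ((e : G.edgeSet), m F e') else 0
  have hM : ∀ F, (M F).det ≠ 0 := by
    intro F h0
    -- Weight 1 on the matched incidences and 0 elsewhere specializes the minor to the identity
    -- matrix.
    let t : G.edgeSet × V → ℂ := fun q => if ∃ h : q.1 ∈ F.1, q.2 = m F ⟨q.1, h⟩ then 1 else 0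
    have h1 := congrArg (eval t) h0
    rw [RingHom.map_det] at h1
    have h2 : (eval t).mapMatrix (M F) = 1 := by
      ext e e'
      rw [RingHom.mapMatrix_apply, Matrix.map_apply, Matrix.one_apply]
      by_cases hee : e = e'
      · subst hee
        simp [M, t, hm F e]
      · have : m F e' ≠ m F e := fun h => hee (hminj F h).symm
        by_cases hin : m F e' ∈ ((e : G.edgeSet) : Sym2 V)
        · simp [M, t, hin, hee, this]
        · simp [M, hin, hee]
    rw [h2, Matrix.det_one, map_zero] at h1
    exact one_ne_zero h1
  obtain ⟨t, ht⟩ : ∃ t, eval t (∏ F, (M F).det) ≠ 0 := by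
    by_contra! hcon
    exact Finset.prod_ne_zero_iff.2 (fun F _ => hM F)
      (MvPolynomial.funext fun x => by rw [hcon x, map_zero])
  rw [map_prod, Finset.prod_ne_zero_iff] at ht
  let ρ : G.edgeSet → V → ℂ := fun e v => if v ∈ (e : Sym2 V) then t (e, v) else 0
  refine exists_representsRows_of_vectors _ rfl ρ fun F => ⟨fun hF => ?_, fun hF => ?_⟩
  · have h1 := ht ⟨F, hF⟩ (Finset.mem_univ _)
    rw [RingHom.map_det] at h1
    have h2 := Matrix.linearIndependent_rows_of_det_ne_zero h1
    refine LinearIndependent.of_comp (LinearMap.funLeft ℂ ℂ (m ⟨F, hF⟩)) ?_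
    have h3 : (LinearMap.funLeft ℂ ℂ (m ⟨F, hF⟩) ∘ fun e : F => ρ e) =
        fun i => (eval t).mapMatrix (M ⟨F, hF⟩) i := by
      funext e e'
      rw [RingHom.mapMatrix_apply, Matrix.map_apply]
      by_cases hin : m ⟨F, hF⟩ e' ∈ ((e : G.edgeSet) : Sym2 V)
      · simp [M, ρ, LinearMap.funLeft_apply, hin]
      · simp [M, ρ, LinearMap.funLeft_apply, hin]
    rw [h3]
    exact h2
  · rw [countMatroid_indep_iff]
    intro I hIF _
    have h1 := card_le_of_linearIndependent_of_vanishing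
      (linearIndependent_restrict_subset hF hIF) (edgeSupport G I) fun x hx hx0 => by
        funext v
        by_cases hvI : v ∈ edgeSupport G I
        · exact hx0 v hvI
        · exact span_eq_zero_of_notMem_edgeSupport G ρ (fun e v hv => if_neg hv) I hx hvI
    rw [Nat.card_coe_set_eq] at h1
    push_cast
    omega

/-! ### Ranks in the graphic and the bicircular matroid -/

theorem edgeSupport_mono {V : Type*} (G : SimpleGraph V) {A B : Set G.edgeSet} (h : A ⊆ B) :
    edgeSupport G A ⊆ edgeSupport G B :=
  fun _ ⟨e, he, hv⟩ => ⟨e, h he, hv⟩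

theorem edgeSupport_union {V : Type*} (G : SimpleGraph V) (A B : Set G.edgeSet) :
    edgeSupport G (A ∪ B) = edgeSupport G A ∪ edgeSupport G B := by
  ext v
  constructor
  · rintro ⟨e, he | he, hv⟩
    exacts [Or.inl ⟨e, he, hv⟩, Or.inr ⟨e, he, hv⟩]
  · rintro (⟨e, he, hv⟩ | ⟨e, he, hv⟩)
    exacts [⟨e, Or.inl he, hv⟩, ⟨e, Or.inr he, hv⟩]

theorem edgeSupport_singleton {V : Type*} (G : SimpleGraph V) (e : G.edgeSet) :
    edgeSupport G {e} = {v | v ∈ (e : Sym2 V)} := by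
  ext v
  simp [edgeSupport]

theorem two_le_ncard_edgeSupport {V : Type*} [Finite V] (G : SimpleGraph V) {I : Set G.edgeSet}
    (hI : I.Nonempty) : 2 ≤ (edgeSupport G I).ncard := by
  obtain ⟨e, he⟩ := hI
  rw [← ncard_mem_edge G e]
  exact Set.ncard_le_ncard fun v hv => ⟨e, he, hv⟩

/-- Adding to a forest an edge with a new vertex gives a forest. -/
theorem graphic_indep_insert {V : Type*} [Finite V] (G : SimpleGraph V) {T : Set G.edgeSet}
    (hT : (countMatroid G 1 1).Indep T) {e : G.edgeSet} {v : V} (hv : v ∈ (e : Sym2 V))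
    (hvT : v ∉ edgeSupport G T) : (countMatroid G 1 1).Indep (insert e T) := by
  rw [countMatroid_indep_iff] at hT ⊢
  intro I hI hne
  by_cases heI : e ∈ I
  · have hsub : I \ {e} ⊆ T := fun x hx => (hI hx.1).resolve_left hx.2
    have hcard := Set.ncard_sdiff_singleton_add_one heI
    have h2 := two_le_ncard_edgeSupport G hne
    rcases (I \ {e}).eq_empty_or_nonempty with h0 | h0
    · rw [h0, Set.ncard_empty] at hcard
      push_cast
      omega
    · have h1 := hT _ hsub h0
      have h3 : edgeSupport G (I \ {e}) ⊂ edgeSupport G I :=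
        ⟨edgeSupport_mono G Set.sdiff_subset, fun h =>
          hvT (edgeSupport_mono G hsub (h ⟨e, heI, hv⟩))⟩
      have h4 := Set.ncard_lt_ncard h3
      push_cast at h1 ⊢
      omega
  · exact hT I (fun x hx => (hI hx).resolve_left fun h => heI (h ▸ hx)) hne

/-- Adding an edge to a forest gives an independent set of the bicircular matroid. -/
theorem bicircular_indep_insert {V : Type*} [Finite V] (G : SimpleGraph V) {T : Set G.edgeSet}
    (hT : (countMatroid G 1 1).Indep T) (e : G.edgeSet) :
    (countMatroid G 1 0).Indep (insert e T) := by
  rw [countMatroid_indep_iff] at hT ⊢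
  intro I hI hne
  have hsub : I \ {e} ⊆ T := fun x hx => (hI hx.1).resolve_left hx.2
  have hcard := Set.ncard_le_ncard_sdiff_add_ncard I {e}
  rw [Set.ncard_singleton] at hcard
  have h2 := two_le_ncard_edgeSupport G hne
  rcases (I \ {e}).eq_empty_or_nonempty with h0 | h0
  · rw [h0, Set.ncard_empty] at hcard
    push_cast
    omega
  · have h1 := hT _ hsub h0
    have h4 := Set.ncard_le_ncard (edgeSupport_mono G (Set.sdiff_subset : I \ {e} ⊆ I))
    push_cast at h1 ⊢
    omega

/-- A set of edges is connected if it is not the union of two vertex-disjoint nonempty sets. -/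
def EdgeConnected {V : Type*} (G : SimpleGraph V) (I : Set G.edgeSet) : Prop :=
  ∀ A ⊆ I, A.Nonempty → (I \ A).Nonempty →
    ¬ Disjoint (edgeSupport G A) (edgeSupport G (I \ A))

/-- A maximal subtree spans: otherwise connectedness supplies an edge of `I` with one endpoint on
the tree and the other off it, and the tree grows. -/
theorem EdgeConnected.exists_spanning_tree {V : Type*} [Finite V] {G : SimpleGraph V}
    {I : Set G.edgeSet} (hI : EdgeConnected G I) (hne : I.Nonempty) :
    ∃ T ⊆ I, (countMatroid G 1 1).Indep T ∧ T.ncard + 1 = (edgeSupport G I).ncard := by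
  let P : Set G.edgeSet → Prop := fun T => T ⊆ I ∧ T.Nonempty ∧
    (countMatroid G 1 1).Indep T ∧ T.ncard + 1 = (edgeSupport G T).ncard
  obtain ⟨e₀, he₀⟩ := hne
  have hP₀ : P {e₀} := by
    have h2 : (edgeSupport G {e₀}).ncard = 2 := by
      rw [edgeSupport_singleton, ncard_mem_edge]
    refine ⟨Set.singleton_subset_iff.2 he₀, ⟨e₀, rfl⟩, ?_, by rw [h2, Set.ncard_singleton]⟩
    rw [countMatroid_indep_iff]
    intro J hJ hJne
    rw [(Set.subset_singleton_iff_eq.1 hJ).resolve_left hJne.ne_empty, h2, Set.ncard_singleton]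
    norm_num
  obtain ⟨T, -, hT⟩ := Finite.exists_le_maximal hP₀
  obtain ⟨hTI, hTne, hTind, hTcard⟩ := hT.prop
  refine ⟨T, hTI, hTind, ?_⟩
  rw [hTcard]
  by_contra hlt
  -- All edges inside `V(T)`, not only those of `T`, so that an edge outside `A` must leave `V(T)`.
  let A : Set G.edgeSet := {e ∈ I | ∀ v ∈ (e : Sym2 V), v ∈ edgeSupport G T}
  have hTA : T ⊆ A := fun e he => ⟨hTI he, fun v hv => ⟨e, he, hv⟩⟩
  have hAT : edgeSupport G A ⊆ edgeSupport G T := fun v ⟨e, he, hv⟩ => he.2 v hv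
  have hIA : (I \ A).Nonempty := by
    by_contra h
    rw [Set.not_nonempty_iff_eq_empty, Set.sdiff_eq_empty] at h
    exact hlt (congrArg Set.ncard (Set.Subset.antisymm (edgeSupport_mono G hTI)
      ((edgeSupport_mono G h).trans hAT)))
  obtain ⟨v, hvA, e, he, hve⟩ :=
    Set.not_disjoint_iff.1 (hI A (fun e he => he.1) (hTne.mono hTA) hIA)
  obtain ⟨w, hwe, hwT⟩ : ∃ w ∈ (e : Sym2 V), w ∉ edgeSupport G T := by
    by_contra! h
    exact he.2 ⟨he.1, h⟩
  have heT : e ∉ T := fun h => hwT ⟨e, h, hwe⟩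
  have hsupp : edgeSupport G (insert e T) = insert w (edgeSupport G T) := by
    rw [Set.insert_eq, edgeSupport_union, edgeSupport_singleton]
    have hvw : v ≠ w := fun h => hwT (h ▸ hAT hvA)
    rw [(Sym2.mem_and_mem_iff hvw).1 ⟨hve, hwe⟩]
    ext x
    have := hAT hvA
    simp only [Sym2.mem_iff, Set.mem_union, Set.mem_ofPred_eq, Set.mem_insert_iff]
    grind
  have hP : P (insert e T) := by
    refine ⟨Set.insert_subset he.1 hTI, Set.insert_nonempty _ _,
      graphic_indep_insert G hTind hwe hwT, ?_⟩
    rw [hsupp, Set.ncard_insert_of_notMem heT, Set.ncard_insert_of_notMem hwT, hTcard]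
  exact heT (hT.le_of_ge hP (Set.subset_insert e T) (Set.mem_insert e T))

/-- A subset that meets both parts satisfies the sum of two counts, which subtracts `2 l ≥ l`. -/
theorem countMatroid_indep_union_of_disjoint {V : Type*} [Finite V] (G : SimpleGraph V) (k l : ℕ)
    {A B : Set G.edgeSet} (hA : (countMatroid G k l).Indep A) (hB : (countMatroid G k l).Indep B)
    (hAB : Disjoint (edgeSupport G A) (edgeSupport G B)) :
    (countMatroid G k l).Indep (A ∪ B) := by
  rw [countMatroid_indep_iff] at hA hB ⊢
  intro I hI hne
  have hIu : I = (I ∩ A) ∪ (I ∩ B) := by rw [← Set.inter_union_distrib_left]; grind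
  rcases (I ∩ A).eq_empty_or_nonempty with h0 | h0
  · rw [h0, Set.empty_union] at hIu
    exact hB I (hIu ▸ Set.inter_subset_right) hne
  rcases (I ∩ B).eq_empty_or_nonempty with h0' | h0'
  · rw [h0', Set.union_empty] at hIu
    exact hA I (hIu ▸ Set.inter_subset_right) hne
  have h1 := hA _ Set.inter_subset_right h0
  have h2 := hB _ Set.inter_subset_right h0'
  have h3 : (edgeSupport G I).ncard =
      (edgeSupport G (I ∩ A)).ncard + (edgeSupport G (I ∩ B)).ncard := by
    conv_lhs => rw [hIu, edgeSupport_union]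
    exact Set.ncard_union_eq (hAB.mono (edgeSupport_mono G Set.inter_subset_right)
      (edgeSupport_mono G Set.inter_subset_right))
  have h4 := Set.ncard_union_le (I ∩ A) (I ∩ B)
  rw [← hIu] at h4
  have h4 : (I.ncard : ℤ) ≤ (I ∩ A).ncard + (I ∩ B).ncard := by exact_mod_cast h4
  rw [h3]
  push_cast
  rw [mul_add]
  linarith [Int.natCast_nonneg l]

theorem matroidRank_add_le_of_disjoint_edgeSupport {V : Type*} [Finite V] (G : SimpleGraph V)
    (k l : ℕ) {A B : Set G.edgeSet} (hAB : Disjoint (edgeSupport G A) (edgeSupport G B)) :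
    matroidRank (countMatroid G k l) A + matroidRank (countMatroid G k l) B ≤
      matroidRank (countMatroid G k l) (A ∪ B) := by
  obtain ⟨I, hIA, hI, hIr⟩ := exists_indep_ncard_eq_matroidRank (countMatroid G k l) A
  obtain ⟨J, hJB, hJ, hJr⟩ := exists_indep_ncard_eq_matroidRank (countMatroid G k l) B
  have hd := hAB.mono (edgeSupport_mono G hIA) (edgeSupport_mono G hJB)
  have h := (countMatroid_indep_union_of_disjoint G k l hI hJ hd).ncard_le_matroidRank
    (Set.union_subset_union hIA hJB)
  have hdIJ : Disjoint I J := Set.disjoint_left.2 fun e heI heJ => by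
    obtain ⟨p, -, hep⟩ := edge_eq_mk G e
    have hp : p.1 ∈ (e : Sym2 V) := by simp [hep]
    exact Set.disjoint_left.1 hd ⟨e, heI, hp⟩ ⟨e, heJ, hp⟩
  rw [Set.ncard_union_eq hdIJ] at h
  push_cast at h
  linarith

theorem matroidRank_countMatroid_one_le {V : Type*} [Finite V] (G : SimpleGraph V) (l : ℕ)
    (hl : l ≤ 1) (X : Set G.edgeSet) (S : Set V) (hS : edgeSupport G X ⊆ S) (hne : S.Nonempty) :
    matroidRank (countMatroid G 1 l) X ≤ S.ncard - l := by
  obtain ⟨I, hIX, hI, hIr⟩ := exists_indep_ncard_eq_matroidRank (countMatroid G 1 l) X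
  rw [← hIr]
  have hpos := (Set.ncard_pos S.toFinite).2 hne
  rcases I.eq_empty_or_nonempty with rfl | h0
  · rw [Set.ncard_empty]
    omega
  · have h1 := (countMatroid_indep_iff G 1 l I).1 hI I subset_rfl h0
    have h2 := Set.ncard_le_ncard ((edgeSupport_mono G hIX).trans hS)
    push_cast at h1
    omega

/-- A nonempty set of edges that is independent in the `(3,4)`-count matroid satisfies the count
for twice the rank in the graphic matroid plus the rank in the bicircular matroid minus two. -/
theorem ncard_le_of_count_three_four_indep {V : Type*} [Finite V] (G : SimpleGraph V)
    (I : Set G.edgeSet) (hI : (countMatroid G 3 4).Indep I) (hne : I.Nonempty) :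
    (I.ncard : ℤ) ≤ 2 * matroidRank (countMatroid G 1 1) I +
      matroidRank (countMatroid G 1 0) I - 2 := by
  induction hn : I.ncard using Nat.strong_induction_on generalizing I with
  | _ n ih =>
  subst hn
  by_cases hconn : EdgeConnected G I
  · obtain ⟨T, hTI, hT, hTcard⟩ := hconn.exists_spanning_tree hne
    have h2 := two_le_ncard_edgeSupport G hne
    have h11 := hT.ncard_le_matroidRank hTI
    -- With `v = |V(I)|`: if `I` is a tree, all three ranks are at least `v - 1`, and `v - 1 ≤ 3 (v
    -- - 1) - 2` because `v ≥ 2`. Otherwise an extra edge raises the bicircular rank to at least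
    -- `v`, and the right side reaches `3 v - 4`.
    by_cases hIT : I ⊆ T
    · have hIT : T = I := Set.Subset.antisymm hTI hIT
      subst hIT
      have h10 := ((bicircular_indep_insert G hT hne.some).subset
        (Set.subset_insert _ _)).ncard_le_matroidRank hTI
      omega
    · obtain ⟨e, heI, heT⟩ := Set.not_subset.1 hIT
      have h10 := (bicircular_indep_insert G hT e).ncard_le_matroidRank
        (Set.insert_subset heI hTI)
      rw [Set.ncard_insert_of_notMem heT] at h10
      have h34 := (countMatroid_indep_iff G 3 4 I).1 hI I subset_rfl hne
      push_cast at h34 h10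
      omega
  -- Ranks add up over vertex-disjoint parts, and the two bounds together subtract 4, more than the
  -- 2 required.
  · simp only [EdgeConnected, not_forall, not_not] at hconn
    obtain ⟨A, hAI, hA, hIA, hd⟩ := hconn
    have hcard := Set.ncard_sdiff_add_ncard_of_subset hAI
    have hA' := (Set.ncard_pos A.toFinite).2 hA
    have hIA' := (Set.ncard_pos (I \ A).toFinite).2 hIA
    have h1 := ih _ (by omega) A (hI.subset hAI) hA rfl
    have h2 := ih _ (by omega) (I \ A) (hI.subset Set.sdiff_subset) hIA rfl
    have h3 := matroidRank_add_le_of_disjoint_edgeSupport G 1 1 hd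
    have h4 := matroidRank_add_le_of_disjoint_edgeSupport G 1 0 hd
    rw [Set.union_sdiff_cancel hAI] at h3 h4
    omega

/-! ### Comparison with the matroid of the conjecture -/

theorem bernsteinFunction_three {ι : Type*} [Finite ι] (L : Fin 3 → Submodule ℂ (ι → ℂ))
    (F : Set ι) : (bernsteinFunction L).toFun F = matroidRank (linearSpaceMatroid (L 0)) F +
      matroidRank (linearSpaceMatroid (L 1)) F + matroidRank (linearSpaceMatroid (L 2)) F - 2 := by
  simp only [bernsteinFunction, Fin.sum_univ_three]
  norm_num

/-- The algebraic matroid of a Hadamard product of three linear spaces is at most the matroid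
induced by the sum of the rank functions minus two. -/
theorem hadamardMatroid_weakLE {ι : Type*} [Finite ι] (L : Fin 3 → Submodule ℂ (ι → ℂ))
    (hL : ∀ i e, ∃ x ∈ L i, x e ≠ 0) :
    WeakLE (hadamardMatroid L) (inducedMatroid (bernsteinFunction L)) := by
  refine ⟨rfl, fun I hI => (inducedMatroid_indep_iff _ _).2 fun J hJI hJ => ?_⟩
  obtain ⟨e, he⟩ := hJ
  -- A single block: the bound reads `(r₀ - 1) + (r₁ - 1) + 1 + (r₂ - 1)`.
  have h := ncard_le_of_algIndep_hadamardProduct L hL J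
    ((algebraicMatroid_indep_iff _ _ J).1 (hI.subset hJI)) (fun _ => ()) (fun _ => e)
    (fun _ => he) (fun _ => rfl)
  have hJ : J ∩ (fun _ => ()) ⁻¹' {()} = J := by ext; simp
  simp only [Finset.univ_unique, Finset.sum_singleton, PUnit.default_eq_unit, hJ,
    Fintype.card_unit] at h
  rw [bernsteinFunction_three]
  push_cast at h
  linarith

theorem ncard_le_choose_edgeSupport {V : Type*} [Finite V] (G : SimpleGraph V)
    (F : Set G.edgeSet) : F.ncard ≤ (edgeSupport G F).ncard.choose 2 := by
  classical
  obtain ⟨_⟩ := nonempty_fintype V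
  rw [Set.ncard_eq_toFinset_card' (edgeSupport G F), ← Sym2.card_image_offDiag,
    ← Set.ncard_image_of_injective F Subtype.val_injective, ← Set.ncard_coe_finset]
  refine Set.ncard_le_ncard ?_
  rintro _ ⟨e, he, rfl⟩
  obtain ⟨p, hp, hep⟩ := edge_eq_mk G e
  simp only [Finset.coe_image, Set.mem_image, Finset.mem_coe, Finset.mem_offDiag, Set.mem_toFinset]
  exact ⟨p, ⟨⟨e, he, by simp [hep]⟩, ⟨e, he, by simp [hep]⟩, hp⟩, hep.symm⟩

/-! ### The cyclic chain of four blocks -/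

instance : DecidableRel hubGraph.Adj := fun p q => by unfold hubGraph; infer_instance

theorem ncard_edgeSet_hubGraph : hubGraph.edgeSet.ncard = 56 := by
  have h := hubGraph.sum_degrees_eq_twice_card_edges
  -- Four hubs of degree 8 and sixteen other vertices of degree 5.
  have h2 : ∑ v, hubGraph.degree v = 112 := by decide +kernel
  rw [← SimpleGraph.coe_edgeFinset, Set.ncard_coe_finset]
  omega

/-- The vertices of the `i`-th block. -/
def hubBlock (i : Fin 4) : Finset (Fin 4 × Fin 5) :=
  Finset.univ.filter fun p => p.1 = i ∨ p = (i + 1, 0)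

theorem mem_hubBlock {i : Fin 4} {p : Fin 4 × Fin 5} :
    p ∈ hubBlock i ↔ p.1 = i ∨ p = (i + 1, 0) := by
  simp [hubBlock]

theorem card_hubBlock (i : Fin 4) : (hubBlock i).card = 6 := by
  decide +revert

theorem exists_hubBlock (e : hubGraph.edgeSet) : ∃ i, ∀ v ∈ (e : Sym2 _), v ∈ hubBlock i := by
  obtain ⟨e, he⟩ := e
  induction e using Sym2.ind with
  | _ p q =>
  simp only [Sym2.mem_iff, forall_eq_or_imp, forall_eq, mem_hubBlock]
  rcases he with h | h | h
  · exact ⟨p.1, Or.inl rfl, Or.inl h.1.symm⟩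
  · exact ⟨p.1, Or.inl rfl, Or.inr (Prod.ext h.1 h.2.2)⟩
  · exact ⟨q.1, Or.inr (Prod.ext h.1 h.2.2), Or.inl rfl⟩

/-- The block of an edge. -/
noncomputable def edgeBlock (e : hubGraph.edgeSet) : Fin 4 := (exists_hubBlock e).choose

theorem mem_hubBlock_edgeBlock (e : hubGraph.edgeSet) :
    ∀ v ∈ (e : Sym2 _), v ∈ hubBlock (edgeBlock e) := (exists_hubBlock e).choose_spec

/-- An edge of the `i`-th block that is not incident to a hub. -/
def innerEdge (i : Fin 4) : hubGraph.edgeSet :=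
  ⟨s((i, 1), (i, 2)), Or.inl ⟨rfl, by simp⟩⟩

/-- The vertex `(i, 1)` lies in no other block, which forces the choice made by `edgeBlock`. -/
theorem edgeBlock_innerEdge (i : Fin 4) : edgeBlock (innerEdge i) = i := by
  have h := mem_hubBlock_edgeBlock (innerEdge i) (i, 1) (by simp [innerEdge])
  rw [mem_hubBlock] at h
  rcases h with h | h
  · exact h.symm
  · exact absurd (congrArg Prod.snd h) (by simp)

theorem edgeSupport_subset_hubBlock {F : Set hubGraph.edgeSet} {i : Fin 4}
    (hF : ∀ e ∈ F, edgeBlock e = i) : edgeSupport hubGraph F ⊆ hubBlock i := by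
  rintro v ⟨e, he, hv⟩
  rw [← hF e he]
  exact mem_hubBlock_edgeBlock e v hv

theorem ncard_le_fourteen {F : Set hubGraph.edgeSet} {i : Fin 4}
    (hF : ∀ e ∈ F, edgeBlock e = i) : F.ncard ≤ 14 := by
  have hcard : (((hubBlock i).offDiag.image (Function.uncurry Sym2.mk)).erase
      s((i, 0), (i + 1, 0))).card = 14 := by
    rw [Finset.card_erase_of_mem, Sym2.card_image_offDiag, card_hubBlock]
    · rfl
    · exact Finset.mem_image.2 ⟨((i, 0), (i + 1, 0)), by
        simp [Finset.mem_offDiag, mem_hubBlock], rfl⟩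
  rw [← hcard, ← Set.ncard_image_of_injective F Subtype.val_injective, ← Set.ncard_coe_finset]
  refine Set.ncard_le_ncard ?_
  rintro _ ⟨e, he, rfl⟩
  obtain ⟨p, hp, hep⟩ := edge_eq_mk _ e
  have hs := edgeSupport_subset_hubBlock hF
  refine Finset.mem_coe.2 (Finset.mem_erase.2 ⟨fun h => ?_, Finset.mem_image.2
    ⟨p, Finset.mem_offDiag.2 ⟨hs ⟨e, he, by simp [hep]⟩, hs ⟨e, he, by simp [hep]⟩, hp⟩,
      hep.symm⟩⟩)
  have hadj : hubGraph.Adj (i, 0) (i + 1, 0) := by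
    have := e.2
    rwa [h] at this
  simp [hubGraph] at hadj

/-- On `v` vertices with `2 ≤ v ≤ 5`, already `v (v - 1) / 2 ≤ 3 v - 4`. For `v = 6` the complete
graph has one edge too many, and the missing hub edge brings 15 down to 14. -/
theorem ncard_add_four_le {F : Set hubGraph.edgeSet} {i : Fin 4}
    (hF : ∀ e ∈ F, edgeBlock e = i) (hne : F.Nonempty) :
    F.ncard + 4 ≤ 3 * (edgeSupport hubGraph F).ncard := by
  have h1 := two_le_ncard_edgeSupport hubGraph hne
  have h2 := Set.ncard_le_ncard (edgeSupport_subset_hubBlock hF)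
  rw [Set.ncard_coe_finset, card_hubBlock] at h2
  have h3 := ncard_le_fourteen hF
  have h4 := ncard_le_choose_edgeSupport hubGraph F
  rw [Nat.choose_two_right] at h4
  generalize (edgeSupport hubGraph F).ncard = v at *
  interval_cases v <;> omega

open Classical in
theorem ncard_eq_sum_indicator {α : Type*} [Fintype α] (S : Set α) :
    S.ncard = ∑ p, if p ∈ S then 1 else 0 := by
  rw [Set.ncard_eq_toFinset_card', Finset.sum_boole]
  simp

/-- Suppose `F` meets `k` blocks. Adding the counts of the blocks subtracts `4 k` and counts shared
hubs twice. At most `k - 1` hubs are shared if `k < 4`, and at most 4 if `k = 4`; the total excess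
`3 (k - 1) - 4 k`, respectively `12 - 16`, is at most `-4`. -/
theorem count_three_four_indep_hubGraph : (countMatroid hubGraph 3 4).Indep Set.univ := by
  classical
  rw [countMatroid_indep_iff]
  intro F _ hne
  let Fi : Fin 4 → Set hubGraph.edgeSet := fun i => {e ∈ F | edgeBlock e = i}
  -- Indicators of the hubs, together with the numbers `P i` and `Q i` of non-hub vertices, turn the
  -- claim into linear arithmetic over the four blocks.
  let χ : Set (Fin 4 × Fin 5) → Fin 4 × Fin 5 → ℕ := fun S p => if p ∈ S then 1 else 0
  have hχ : ∀ S p, χ S p ≤ 1 := fun S p => by simp only [χ]; split_ifs <;> omega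
  have hχm : ∀ i p, χ (edgeSupport hubGraph (Fi i)) p ≤ χ (edgeSupport hubGraph F) p := by
    intro i p
    have : p ∈ edgeSupport hubGraph (Fi i) → p ∈ edgeSupport hubGraph F :=
      fun h => edgeSupport_mono _ (fun e he => he.1) h
    simp only [χ]
    split_ifs <;> simp_all
  let P : Fin 4 → ℕ := fun i => ∑ j : Fin 4, χ (edgeSupport hubGraph (Fi i)) (i, j.succ)
  let Q : Fin 4 → ℕ := fun i => ∑ j : Fin 4, χ (edgeSupport hubGraph F) (i, j.succ)
  have hPQ : ∀ i, P i ≤ Q i := fun i => Finset.sum_le_sum fun j _ => hχm i _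
  have hV : (edgeSupport hubGraph F).ncard =
      ∑ i, (χ (edgeSupport hubGraph F) (i, 0) + Q i) := by
    rw [ncard_eq_sum_indicator, Fintype.sum_prod_type]
    exact Finset.sum_congr rfl fun i _ => Fin.sum_univ_succ _
  have hVi : ∀ i, (edgeSupport hubGraph (Fi i)).ncard =
      χ (edgeSupport hubGraph (Fi i)) (i, 0) + P i +
        χ (edgeSupport hubGraph (Fi i)) (i + 1, 0) := by
    intro i
    have hsub : edgeSupport hubGraph (Fi i) ⊆ hubBlock i :=
      edgeSupport_subset_hubBlock fun e he => he.2
    have hii : i ≠ i + 1 := by simp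
    have h0 : ∀ i' j, i' ≠ i → (i', j) ≠ ((i + 1, 0) : Fin 4 × Fin 5) →
        χ (edgeSupport hubGraph (Fi i)) (i', j) = 0 := fun i' j h1 h2 =>
      if_neg fun h => (mem_hubBlock.1 (hsub h)).elim h1 h2
    rw [ncard_eq_sum_indicator, Fintype.sum_prod_type, ← Finset.add_sum_erase _ _
      (Finset.mem_univ i), Finset.sum_eq_single (i + 1), Fin.sum_univ_succ]
    · rw [Finset.sum_eq_single 0 (fun j _ hj => h0 _ _ hii.symm (by simpa using hj)) (by simp)]
    · intro i' hi' hne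
      exact Finset.sum_eq_zero fun j _ => h0 _ _ (Finset.ne_of_mem_erase hi') (by simp [hne])
    · intro h
      exact absurd (Finset.mem_erase.2 ⟨hii.symm, Finset.mem_univ _⟩) h
  have hF : F.ncard = ∑ i, (Fi i).ncard := by
    have := Finset.card_eq_sum_card_fiberwise (s := F.toFinset) (t := Finset.univ)
      (f := edgeBlock) (fun _ _ => Finset.mem_coe.2 (Finset.mem_univ _))
    rw [Set.ncard_eq_toFinset_card', this]
    refine Finset.sum_congr rfl fun i _ => ?_
    rw [← Set.ncard_coe_finset]
    congr 1
    ext e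
    simp [Fi]
  have hblock : ∀ i, ((Fi i).ncard = 0 ∧ χ (edgeSupport hubGraph (Fi i)) (i, 0) = 0 ∧
      χ (edgeSupport hubGraph (Fi i)) (i + 1, 0) = 0) ∨
      (Fi i).ncard + 4 ≤ 3 * (edgeSupport hubGraph (Fi i)).ncard := by
    intro i
    rcases (Fi i).eq_empty_or_nonempty with h | h
    · left
      simp [h, χ, edgeSupport]
    · exact Or.inr (ncard_add_four_le (fun e he => he.2) h)
  have hpos := (Set.ncard_pos F.toFinite).2 hne
  simp only [hVi] at hblock
  simp only [Fin.sum_univ_four] at hF hV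
  have b0 := hblock 0
  have b1 := hblock 1
  have b2 := hblock 2
  have b3 := hblock 3
  have e1 : (0 : Fin 4) + 1 = 1 := rfl
  have e2 : (1 : Fin 4) + 1 = 2 := rfl
  have e3 : (2 : Fin 4) + 1 = 3 := rfl
  have e4 : (3 : Fin 4) + 1 = 0 := rfl
  rw [e1] at b0
  rw [e2] at b1
  rw [e3] at b2
  rw [e4] at b3
  have q0 := hPQ 0
  have q1 := hPQ 1
  have q2 := hPQ 2
  have q3 := hPQ 3
  have h0 := hχm 0 (0, 0)
  have h1 := hχm 1 (1, 0)
  have h2 := hχm 2 (2, 0)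
  have h3 := hχm 3 (3, 0)
  have g0 := hχm 0 (1, 0)
  have g1 := hχm 1 (2, 0)
  have g2 := hχm 2 (3, 0)
  have g3 := hχm 3 (0, 0)
  have c0 := hχ (edgeSupport hubGraph F) (0, 0)
  have c1 := hχ (edgeSupport hubGraph F) (1, 0)
  have c2 := hχ (edgeSupport hubGraph F) (2, 0)
  have c3 := hχ (edgeSupport hubGraph F) (3, 0)
  push_cast
  omega

/-! ### The rank drop and the counterexample -/

theorem hadamardMatroid_hubGraph_rank_le {L : Fin 3 → Submodule ℂ (hubGraph.edgeSet → ℂ)}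
    (hL : ∀ i e, ∃ x ∈ L i, x e ≠ 0)
    (h0 : linearSpaceMatroid (L 0) = countMatroid hubGraph 1 1)
    (h1 : linearSpaceMatroid (L 1) = countMatroid hubGraph 1 1)
    (h2 : linearSpaceMatroid (L 2) = countMatroid hubGraph 1 0) :
    matroidRank (hadamardMatroid L) Set.univ ≤ 55 := by
  obtain ⟨I, -, hI, hIr⟩ := exists_indep_ncard_eq_matroidRank (hadamardMatroid L) Set.univ
  rw [← hIr]
  by_contra! hlt
  have hE : (Set.univ : Set hubGraph.edgeSet).ncard = 56 := by
    rw [Set.ncard_univ, Nat.card_coe_set_eq, ncard_edgeSet_hubGraph]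
  have hIuniv : I = Set.univ :=
    Set.eq_of_subset_of_ncard_le (Set.subset_univ I) (by omega)
  subst hIuniv
  -- If the rank exceeded 55, all of `E` would be independent; the four-block bound then gives `56 ≤
  -- 16 + 16 + 4 + 19`.
  have h := ncard_le_of_algIndep_hadamardProduct L hL Set.univ
    ((algebraicMatroid_indep_iff _ _ _).1 hI) edgeBlock innerEdge (fun _ => Set.mem_univ _)
    edgeBlock_innerEdge
  rw [h0, h1, h2] at h
  have hb : ∀ i, matroidRank (countMatroid hubGraph 1 1) (Set.univ ∩ edgeBlock ⁻¹' {i}) - 1 ≤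
      4 := fun i => by
    have := matroidRank_countMatroid_one_le hubGraph 1 le_rfl (Set.univ ∩ edgeBlock ⁻¹' {i})
      (hubBlock i) (edgeSupport_subset_hubBlock fun e he => he.2) ⟨(i, 0), by simp [mem_hubBlock]⟩
    rw [Set.ncard_coe_finset, card_hubBlock] at this
    push_cast at this
    linarith
  have hu := matroidRank_countMatroid_one_le hubGraph 0 zero_le_one Set.univ Set.univ
    (Set.subset_univ _) ⟨(0, 0), trivial⟩
  have hs := Finset.sum_le_sum (s := Finset.univ) fun i _ => hb i
  rw [Set.ncard_univ, Nat.card_eq_fintype_card] at hu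
  simp only [Fintype.card_prod, Fintype.card_fin, Finset.sum_const, Finset.card_univ,
    nsmul_eq_mul] at hu hs h
  push_cast at hu hs
  omega

theorem Matroid.Indep.matroidRank_eq {E : Type*} {M : Matroid E} {I : Set E} (hI : M.Indep I) :
    matroidRank M I = I.ncard := by
  rw [matroidRank, hI.eRk_eq_encard]
  rfl

theorem mainTheorem3 :
    -- `hubGraph` is `(3,4)`-tight
    ((countMatroid hubGraph 3 4).Indep Set.univ ∧
      (hubGraph.edgeSet.ncard : ℤ) = 3 * Fintype.card (Fin 4 × Fin 5) - 4) ∧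
    -- the graphic and the bicircular matroid have representations over `ℂ`
    (∃ (m : ℕ) (X₁₁ : Matrix hubGraph.edgeSet (Fin m) ℂ),
      RepresentsRows X₁₁ (countMatroid hubGraph 1 1)) ∧
    (∃ (n : ℕ) (X₁₀ : Matrix hubGraph.edgeSet (Fin n) ℂ),
      RepresentsRows X₁₀ (countMatroid hubGraph 1 0)) ∧
    ∀ (m n : ℕ) (X₁₁ : Matrix hubGraph.edgeSet (Fin m) ℂ)
      (X₁₀ : Matrix hubGraph.edgeSet (Fin n) ℂ),
      RepresentsRows X₁₁ (countMatroid hubGraph 1 1) →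
      RepresentsRows X₁₀ (countMatroid hubGraph 1 0) →
      ∀ L : Fin 3 → Submodule ℂ (hubGraph.edgeSet → ℂ),
        L = ![columnSpace X₁₁, columnSpace X₁₁, columnSpace X₁₀] →
        -- no `L i` lies in a coordinate hyperplane
        (∀ i e, ∃ x ∈ L i, x e ≠ 0) ∧
        -- `M(L_{1,1})` and `M(L_{1,0})` are the graphic and the bicircular matroid
        linearSpaceMatroid (columnSpace X₁₁) = countMatroid hubGraph 1 1 ∧
        linearSpaceMatroid (columnSpace X₁₀) = countMatroid hubGraph 1 0 ∧
        WeakLT (hadamardMatroid L) (inducedMatroid (bernsteinFunction L)) ∧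
        matroidRank (hadamardMatroid L) Set.univ ≤ 3 * Fintype.card (Fin 4 × Fin 5) - 5 ∧
        inducedMatroid (bernsteinFunction L) = countMatroid hubGraph 3 4 ∧
        matroidRank (inducedMatroid (bernsteinFunction L)) Set.univ =
          3 * Fintype.card (Fin 4 × Fin 5) - 4 := by

  have hcard : Fintype.card (Fin 4 × Fin 5) = 20 := rfl
  have htight := count_three_four_indep_hubGraph
  refine ⟨⟨htight, by rw [ncard_edgeSet_hubGraph, hcard]; norm_num⟩,
    exists_represents_graphic _, exists_represents_bicircular _, ?_⟩
  rintro m n X₁₁ X₁₀ h11 h10 L rfl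
  have hM11 := h11.linearSpaceMatroid_columnSpace
  have hM10 := h10.linearSpaceMatroid_columnSpace
  set L := ![columnSpace X₁₁, columnSpace X₁₁, columnSpace X₁₀]
  have hsingle : ∀ l ≤ 1, ∀ e, (countMatroid hubGraph 1 l).Indep {e} := by
    intro l hl e
    rw [countMatroid_indep_iff]
    intro I hI hne
    have h1 := two_le_ncard_edgeSupport hubGraph hne
    have h2 := Set.ncard_le_ncard hI
    rw [Set.ncard_singleton] at h2
    push_cast
    omega
  have hL : ∀ i e, ∃ x ∈ L i, x e ≠ 0 := by
    intro i e
    rw [← linearSpaceMatroid_indep_singleton_iff]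
    fin_cases i
    · exact hM11 ▸ hsingle 1 le_rfl e
    · exact hM11 ▸ hsingle 1 le_rfl e
    · exact hM10 ▸ hsingle 0 zero_le_one e
  have hle := hadamardMatroid_hubGraph_rank_le hL hM11 hM11 hM10
  have hind : (inducedMatroid (bernsteinFunction L)).Indep Set.univ := by
    rw [inducedMatroid_indep_iff]
    intro I _ hne
    have h := ncard_le_of_count_three_four_indep hubGraph I
      (htight.subset (Set.subset_univ I)) hne
    rw [bernsteinFunction_three]
    change _ ≤ matroidRank (linearSpaceMatroid (columnSpace X₁₁)) I +
      matroidRank (linearSpaceMatroid (columnSpace X₁₁)) I +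
      matroidRank (linearSpaceMatroid (columnSpace X₁₀)) I - 2
    rw [hM11, hM10]
    linarith
  have hrank : matroidRank (inducedMatroid (bernsteinFunction L)) Set.univ = 56 := by
    rw [hind.matroidRank_eq, Set.ncard_univ, Nat.card_coe_set_eq, ncard_edgeSet_hubGraph]
    rfl
  refine ⟨hL, hM11, hM10, ⟨hadamardMatroid_weakLE L hL, fun h => ?_⟩, ?_, ?_, ?_⟩
  · rw [h, hrank] at hle
    norm_num at hle
  · rw [hcard]
    norm_num
    exact hle
  -- Both matroids are free, as the whole edge set is independent in each.
  · exact Matroid.ext_indep rfl fun I _ =>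
      ⟨fun _ => htight.subset (Set.subset_univ I), fun _ => hind.subset (Set.subset_univ I)⟩
  · rw [hrank, hcard]
    norm_num
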